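/- Let $n\ge 1$ be an integer. A polynomial $f\in\mathbb{R}[z_1,\ldots,z_n]$ is called real stable if $f(z_1,\ldots,z_n)\neq 0$ for all $(z_1,\ldots,z_n)\in\mathbb{C}^n$ with $\operatorname{Im}(z_j)>0$ for $1\le j\le n$. A map $\lambda:\mathbb{N}^n\to\mathbb{R}$ (where $0\in\mathbb{N}$) is called a multivariate multiplier sequence if the linear operator $T$ on polynomials determined by $T(z^\alpha)=\lambda(\alpha)z^\alpha$ for all $\alpha\in\mathbb{N}^n$ maps every real stable polynomial in $z_1,\ldots,z_n$ to a polynomial that is real stable or identically zero. A map $\mu:\mathbb{N}\to\mathbb{R}$ is called a (univariate) multiplier sequence if the linear operator determined by $z^k\mapsto\mu(k)z^k$ for all $k\in\mathbb{N}$ maps every nonzero univariate real polynomial with only real zeros to a polynomial that is either identically zero or nonzero with only real zeros. **Theorem.** Let $\lambda:\mathbb{N}^n\to\mathbb{R}$ be an arbitrary map. Then $\lambda$ is a multivariate multiplier sequence if and only if the following two conditions both hold: 1. there exist univariate multiplier sequences $\lambda_1,\ldots,\lambda_n:\mathbb{N}\to\mathbb{R}$ such that $\lambda(\alpha)=\lambda_1(\alpha_1)\lambda_2(\alpha_2)\cdots\lambda_n(\alpha_n)$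 for all $\alpha=(\alpha_1,\ldots,\alpha_n)\in\mathbb{N}^n$; 2. either $\lambda(\alpha)\lambda(\beta)\ge 0$ for all $\alpha,\beta\in\mathbb{N}^n$, or $(-1)^{|\alpha|+|\beta|}\lambda(\alpha)\lambda(\beta)\ge 0$ for all $\alpha,\beta\in\mathbb{N}^n$, where $|\alpha|=\alpha_1+\cdots+\alpha_n$. -/

import Mathlib

noncomputable section

namespace RealStability

/-- A polynomial `f ∈ ℂ[z₁, …, zₙ]` is stable if it has no zero `z ∈ ℂⁿ` all of whose coordinates
have positive imaginary part. -/
def IsStable {n : ℕ} (f : MvPolynomial (Fin n) ℂ) : Prop :=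
  ∀ z : Fin n → ℂ, (∀ j, 0 < (z j).im) → MvPolynomial.eval z f ≠ 0

/-- A real stable polynomial: a stable polynomial with real coefficients. -/
def IsRealStable {n : ℕ} (f : MvPolynomial (Fin n) ℝ) : Prop :=
  IsStable (MvPolynomial.map (algebraMap ℝ ℂ) f)

/-- The diagonal linear operator `T` on `ℝ[z₁, …, zₙ]` with `T(z^α) = lam(α) z^α`. -/
def diagonalOperator {n : ℕ} (lam : (Fin n → ℕ) → ℝ) :
    MvPolynomial (Fin n) ℝ →ₗ[ℝ] MvPolynomial (Fin n) ℝ :=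
  (MvPolynomial.basisMonomials (Fin n) ℝ).constr ℝ
    fun α => lam α • MvPolynomial.monomial α (1 : ℝ)

theorem diagonalOperator_monomial {n : ℕ} (lam : (Fin n → ℕ) → ℝ) (α : Fin n →₀ ℕ) :
    diagonalOperator lam (MvPolynomial.monomial α 1) =
      lam α • MvPolynomial.monomial α (1 : ℝ) := by
  have h : MvPolynomial.monomial α (1 : ℝ) = MvPolynomial.basisMonomials (Fin n) ℝ α := by
    rw [MvPolynomial.coe_basisMonomials]
  conv_lhs => rw [h]
  rw [diagonalOperator, Module.Basis.constr_basis]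

/-- A multivariate multiplier sequence: the diagonal operator maps every real stable polynomial
to a real stable polynomial or to `0`. -/
def IsMultivariateMultiplierSequence {n : ℕ} (lam : (Fin n → ℕ) → ℝ) : Prop :=
  ∀ f : MvPolynomial (Fin n) ℝ, IsRealStable f →
    IsRealStable (diagonalOperator lam f) ∨ diagonalOperator lam f = 0

/-- A univariate real polynomial is hyperbolic if it is nonzero and all its complex zeros are
real. -/
def IsHyperbolic (p : Polynomial ℝ) : Prop :=
  p ≠ 0 ∧ ∀ z : ℂ, Polynomial.aeval z p = 0 → z.im = 0

/-- The diagonal linear operator `T` on `ℝ[z]` with `T(z^k) = mu(k) z^k`. -/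
def univariateDiagonalOperator (mu : ℕ → ℝ) : Polynomial ℝ →ₗ[ℝ] Polynomial ℝ :=
  (Polynomial.basisMonomials ℝ).constr ℝ fun k => mu k • (Polynomial.X : Polynomial ℝ) ^ k

theorem univariateDiagonalOperator_X_pow (mu : ℕ → ℝ) (k : ℕ) :
    univariateDiagonalOperator mu (Polynomial.X ^ k) =
      mu k • (Polynomial.X : Polynomial ℝ) ^ k := by
  have h : (Polynomial.X : Polynomial ℝ) ^ k = Polynomial.basisMonomials ℝ k := by
    rw [Polynomial.coe_basisMonomials, Polynomial.X_pow_eq_monomial]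
  conv_lhs => rw [h]
  rw [univariateDiagonalOperator, Module.Basis.constr_basis]

/-- A (univariate) multiplier sequence: the diagonal operator maps every hyperbolic polynomial
to a hyperbolic polynomial or to `0`. -/
def IsMultiplierSequence (mu : ℕ → ℝ) : Prop :=
  ∀ p : Polynomial ℝ, IsHyperbolic p →
    IsHyperbolic (univariateDiagonalOperator mu p) ∨ univariateDiagonalOperator mu p = 0

end RealStability

end

/-!
A multivariate multiplier sequence is a product of multiplier sequences in the separate variables,
with a coherent sign pattern. The two implications have independent proofs.

*Sufficiency.* The substitution `z ↦ -z` preserves real stability, so an alternating sign can be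
removed and all factors can be taken nonnegative; they are then applied one variable at a time.
For a nonnegative multiplier sequence `μ`, the polynomial `∑ (d choose k) μ(k) x ^ k` has only
nonpositive real zeros, hence factors into linear forms `r x + t` with `r, t ≥ 0`
(`exists_linear_factors`). If `r, t > 0`, each linear form acts on a polynomial of degree at most
`d` as a polar derivative whose pole `ζ` is afterwards set equal to the variable. Laguerre's theorem
(`polar_derivative_ne_zero`) then gives nonvanishing on the upper half-plane by induction on the
number of factors (`schur_szego_ne_zero`). The case `r, t ≥ 0` is a limit, controlled by Hurwitz's
theorem for polynomials of bounded degree (`isRealStable_or_eq_zero_of_tendsto`).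

*Necessity.* Explicit test polynomials suffice. Multiples of `(1 + z_i)(1 ± z_j)` by monomials show
that all minors `λ(x) λ(x + e_i + e_j) - λ(x + e_i) λ(x + e_j)` with `i ≠ j` vanish (`minor`), and
multiples of `z_i z_j - 1` show that `λ(x) λ(x + e_i + e_j) ≥ 0` (`two_step_nonneg`). The zeros of
`λ` are controlled as follows. If `λ` vanished on a box except at two opposite corners `α`, `β` at
distance at least two, products of hyperbolic polynomials in one variable would make both binomials
`± λ(α) z^α + λ(β) z^β` stable, and one of them is not (`exists_between`). Together with the
vanishing minors, this shows that the support of `λ` contains the box spanned by any two of its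
points (`ne_zero_of_inBox`). In particular the support has a least point, from which the
factorization (`factorization`) and the sign pattern (`sign_nonneg`) spread by unit steps.
-/

/-! ### Diagonal operators and evaluation -/

namespace RealStability

theorem coeff_diagonalOperator {n : ℕ} (lam : (Fin n → ℕ) → ℝ) (f : MvPolynomial (Fin n) ℝ)
    (α : Fin n →₀ ℕ) :
    MvPolynomial.coeff α (diagonalOperator lam f) = lam α * MvPolynomial.coeff α f := by
  induction f using MvPolynomial.induction_on' with
  | monomial β b =>
    rw [← mul_one b, ← smul_eq_mul, ← MvPolynomial.smul_monomial, map_smul,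
      diagonalOperator_monomial]
    simp only [MvPolynomial.coeff_smul, MvPolynomial.coeff_monomial, smul_eq_mul]
    split_ifs with h0
    · subst h0; ring
    · ring
  | add p q hp hq =>
    rw [map_add, MvPolynomial.coeff_add, MvPolynomial.coeff_add, hp, hq, mul_add]

theorem coeff_univariateDiagonalOperator (mu : ℕ → ℝ) (p : Polynomial ℝ) (k : ℕ) :
    (univariateDiagonalOperator mu p).coeff k = mu k * p.coeff k := by
  induction p using Polynomial.induction_on' with
  | add p q hp hq => rw [map_add, Polynomial.coeff_add, Polynomial.coeff_add, hp, hq, mul_add]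
  | monomial m a =>
    rw [← mul_one a, ← smul_eq_mul, ← Polynomial.smul_monomial, map_smul,
      ← Polynomial.X_pow_eq_monomial, univariateDiagonalOperator_X_pow]
    simp only [Polynomial.coeff_smul, Polynomial.coeff_X_pow, smul_eq_mul]
    split_ifs with h0
    · subst h0; ring
    · ring

theorem diagonalOperator_comp {n : ℕ} (lam mu : (Fin n → ℕ) → ℝ) (f : MvPolynomial (Fin n) ℝ) :
    diagonalOperator lam (diagonalOperator mu f) = diagonalOperator (fun α => lam α * mu α) f := by
  ext α
  simp only [coeff_diagonalOperator, mul_assoc]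

/-- The complex value of a real polynomial at a point of `ℂⁿ`. -/
noncomputable def evalC {n : ℕ} (z : Fin n → ℂ) : MvPolynomial (Fin n) ℝ →ₐ[ℝ] ℂ := MvPolynomial.aeval z

theorem isRealStable_iff {n : ℕ} {f : MvPolynomial (Fin n) ℝ} :
    IsRealStable f ↔ ∀ z : Fin n → ℂ, (∀ j, 0 < (z j).im) → evalC z f ≠ 0 := by
  unfold IsRealStable IsStable evalC
  simp only [MvPolynomial.eval_map, MvPolynomial.aeval_def]

theorem evalC_monomial {n : ℕ} (z : Fin n → ℂ) (α : Fin n →₀ ℕ) (a : ℝ) :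
    evalC z (MvPolynomial.monomial α a) = (a : ℂ) * ∏ i, z i ^ α i := by
  rw [evalC, MvPolynomial.aeval_monomial, Finsupp.prod_fintype _ _ (by simp)]
  rfl

theorem evalC_eq_sum {n : ℕ} (z : Fin n → ℂ) (f : MvPolynomial (Fin n) ℝ) :
    evalC z f = ∑ α ∈ f.support, ((MvPolynomial.coeff α f : ℝ) : ℂ) * ∏ i, z i ^ α i := by
  conv_lhs => rw [f.as_sum, map_sum]
  exact Finset.sum_congr rfl fun α _ => evalC_monomial z α _

theorem evalC_diagonalOperator {n : ℕ} (lam : (Fin n → ℕ) → ℝ) (z : Fin n → ℂ)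
    (f : MvPolynomial (Fin n) ℝ) :
    evalC z (diagonalOperator lam f) =
      ∑ α ∈ f.support, ((lam α : ℂ) * (MvPolynomial.coeff α f : ℝ)) * ∏ i, z i ^ α i := by
  conv_lhs => rw [f.as_sum, map_sum, map_sum]
  refine Finset.sum_congr rfl fun α _ => ?_
  rw [← mul_one (MvPolynomial.coeff α f), ← smul_eq_mul, ← MvPolynomial.smul_monomial, map_smul,
    diagonalOperator_monomial, map_smul, map_smul, evalC_monomial]
  simp only [Complex.real_smul, smul_eq_mul, Complex.ofReal_mul, Complex.ofReal_one]
  ring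

/-- Zeros of real polynomials come in conjugate pairs, so it is enough to look at the upper
half-plane. -/
theorem isHyperbolic_iff {p : Polynomial ℝ} :
    IsHyperbolic p ↔ ∀ z : ℂ, 0 < z.im → Polynomial.aeval z p ≠ 0 := by
  constructor
  · rintro ⟨-, h⟩ z hz h0
    exact hz.ne' (h z h0)
  · intro h
    refine ⟨fun h0 => h Complex.I (by simp) (by simp [h0]), fun z hz => ?_⟩
    by_contra hne
    rcases lt_or_gt_of_ne hne with hlt | hgt
    · refine h (starRingEnd ℂ z) (by simpa using hlt) ?_
      rw [Polynomial.aeval_conj, hz, map_zero]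
    · exact h z hgt hz

theorem prod_pow_ne_zero {n : ℕ} {z : Fin n → ℂ} (hz : ∀ j, 0 < (z j).im) (α : Fin n → ℕ)
    (s : Finset (Fin n)) : ∏ i ∈ s, z i ^ α i ≠ 0 :=
  Finset.prod_ne_zero_iff.2 fun i _ => pow_ne_zero _ fun h => by simpa [h] using hz i

/-! ### Laguerre's theorem and Schur–Szegő composition -/

/-- The inversion `w ↦ 1 / (z - w)` maps the closed lower half-plane into a disc. -/
theorem norm_inv_sub_add_le_iff {z w : ℂ} (hz : 0 < z.im) (hzw : z ≠ w) :
    ‖1 / (z - w) + Complex.I / (2 * z.im)‖ ≤ 1 / (2 * z.im) ↔ w.im ≤ 0 := by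
  have hv : z - w ≠ 0 := sub_ne_zero.2 hzw
  have hy : (z.im : ℂ) ≠ 0 := Complex.ofReal_ne_zero.2 hz.ne'
  have h1 : 1 / (z - w) + Complex.I / (2 * z.im) =
      (2 * z.im + Complex.I * (z - w)) / ((z - w) * (2 * z.im)) := by
    field_simp
  have h2 : ‖(2 * z.im : ℂ)‖ = 2 * z.im := by
    simp [abs_of_pos hz]
  rw [h1, norm_div, norm_mul, h2, ← div_div, div_le_div_iff_of_pos_right (by positivity),
    div_le_one (norm_pos_iff.2 hv), ← sq_le_sq₀ (norm_nonneg _) (norm_nonneg _),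
    Complex.sq_norm, Complex.sq_norm, Complex.normSq_apply, Complex.normSq_apply]
  simp
  constructor
  · intro h
    by_contra hw
    push Not at hw
    nlinarith [mul_pos hz hw]
  · intro h
    nlinarith [mul_nonneg hz.le (neg_nonneg.2 h)]

open Polynomial in
/-- **Laguerre's theorem** for the upper half-plane: if `f` has degree at most `d` and no zeros in
the upper half-plane, then its polar derivative with respect to a point `ζ` of the upper half-plane
has no zeros there either. -/
theorem polar_derivative_ne_zero {f : ℂ[X]} {d : ℕ} (hd : d ≠ 0) (hfd : f.natDegree ≤ d)
    (hf : ∀ z : ℂ, 0 < z.im → f.eval z ≠ 0) {z ζ : ℂ} (hz : 0 < z.im) (hζ : 0 < ζ.im) :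
    d * f.eval z + (ζ - z) * f.derivative.eval z ≠ 0 := by
  intro h0
  have hfz := hf z hz
  have hd' : (d : ℂ) ≠ 0 := Nat.cast_ne_zero.2 hd
  have hζz : ζ ≠ z := by
    rintro rfl
    rw [sub_self, zero_mul, add_zero] at h0
    exact mul_ne_zero hd' hfz h0
  have hlog := (IsAlgClosed.splits f).eval_derivative_div_eval_of_ne_zero hfz
  set S := (f.roots.map fun a => 1 / (z - a)).sum with hS
  -- The logarithmic derivative lies in `d` times the disc of `norm_inv_sub_add_le_iff`.
  have key : ∀ m : Multiset ℂ, (∀ a ∈ m, a.im ≤ 0) →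
      ‖(m.map fun a => 1 / (z - a)).sum + m.card * (Complex.I / (2 * z.im))‖ ≤
        m.card * (1 / (2 * z.im)) := by
    intro m
    induction m using Multiset.induction_on with
    | empty => simp
    | cons a m ih =>
      intro hm
      have ha : a.im ≤ 0 := hm a (Multiset.mem_cons_self a m)
      have h1 := (norm_inv_sub_add_le_iff hz (w := a) (by rintro rfl; linarith)).2 ha
      have h2 := ih fun b hb => hm b (Multiset.mem_cons_of_mem hb)
      rw [Multiset.map_cons, Multiset.sum_cons, Multiset.card_cons, Nat.cast_succ, Nat.cast_succ]
      calc _ = ‖(1 / (z - a) + Complex.I / (2 * z.im)) +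
            ((m.map fun a => 1 / (z - a)).sum + m.card * (Complex.I / (2 * z.im)))‖ := by
            congr 1; ring
        _ ≤ _ := (norm_add_le _ _).trans (by linarith)
  have hroots := key f.roots fun a ha => by
    by_contra hlt
    exact hf a (not_le.1 hlt) (isRoot_of_mem_roots ha)
  have hcard : f.roots.card ≤ d := (card_roots' f).trans hfd
  have hS' : ‖S + d * (Complex.I / (2 * z.im))‖ ≤ d * (1 / (2 * z.im)) := by
    have h3 : ((d - f.roots.card : ℕ) : ℂ) = d - f.roots.card := by push_cast [hcard]; ring
    have h4 : ((d - f.roots.card : ℕ) : ℝ) = d - f.roots.card := by push_cast [hcard]; ring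
    have h5 : ‖((d - f.roots.card : ℕ) : ℂ) * (Complex.I / (2 * z.im))‖ =
        (d - f.roots.card : ℕ) * (1 / (2 * z.im)) := by
      rw [norm_mul, norm_div, norm_mul]
      simp [abs_of_pos hz]
    calc _ = ‖(S + f.roots.card * (Complex.I / (2 * z.im))) +
          ((d - f.roots.card : ℕ) : ℂ) * (Complex.I / (2 * z.im))‖ := by
            rw [h3]; congr 1; ring
      _ ≤ f.roots.card * (1 / (2 * z.im)) + (d - f.roots.card : ℕ) * (1 / (2 * z.im)) := by
            refine (norm_add_le _ _).trans ?_
            rw [h5]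
            exact add_le_add_left hroots _
      _ = _ := by rw [h4]; ring
  have hSζ : S = d * (1 / (z - ζ)) := by
    rw [← hlog]
    have : z - ζ ≠ 0 := sub_ne_zero.2 hζz.symm
    field_simp
    linear_combination -h0
  have h6 : ‖1 / (z - ζ) + Complex.I / (2 * z.im)‖ ≤ 1 / (2 * z.im) := by
    rw [hSζ, ← mul_add, norm_mul, Complex.norm_natCast] at hS'
    exact le_of_mul_le_mul_left hS' (by positivity)
  exact absurd ((norm_inv_sub_add_le_iff hz hζz.symm).1 h6) (not_le.2 hζ)

open Polynomial in
/-- A form of the Grace–Walsh–Szegő theorem. The coefficients of `∏ (r X + t)`, divided by binomial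
coefficients, are the weights of a composition that preserves nonvanishing on the upper
half-plane. Each linear factor contributes one polar derivative. -/
theorem schur_szego_ne_zero (s : Multiset (ℝ × ℝ)) (hs : ∀ a ∈ s, 0 < a.1 ∧ 0 < a.2) {f : ℂ[X]}
    (hfd : f.natDegree ≤ s.card) (hf : ∀ z : ℂ, 0 < z.im → f.eval z ≠ 0) {z : ℂ} (hz : 0 < z.im) :
    ∑ k ∈ Finset.range (s.card + 1),
      (((s.map fun a : ℝ × ℝ => C a.1 * X + C a.2).prod.coeff k / (s.card.choose k : ℝ) : ℝ) : ℂ) *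
        f.coeff k * z ^ k ≠ 0 := by
  induction s using Multiset.induction_on generalizing f with
  | empty =>
    have h := hf z hz
    rw [eval_eq_sum_range' (n := 1) (by simpa using Nat.lt_succ_of_le hfd)] at h
    simpa using h
  | cons a s ih =>
    set d := s.card with hd
    set Q := (s.map fun a : ℝ × ℝ => C a.1 * X + C a.2).prod with hQ
    obtain ⟨hr, ht⟩ := hs a (Multiset.mem_cons_self a s)
    rw [Multiset.card_cons] at hfd
    have hQd : Q.coeff (d + 1) = 0 := by
      refine coeff_eq_zero_of_natDegree_lt (Nat.lt_succ_of_le ?_)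
      refine (natDegree_multiset_prod_le _).trans ?_
      rw [Multiset.map_map]
      refine (Multiset.sum_le_card_nsmul _ 1 fun x hx => ?_).trans (by simp [hd])
      obtain ⟨b, -, rfl⟩ := Multiset.mem_map.1 hx
      exact natDegree_linear_le
    -- `z` enters `g` as the pole of the polar derivative and is kept fixed there.
    set g : ℂ[X] := C (a.2 : ℂ) * (C ((d : ℂ) + 1) * f - X * derivative f) +
      C ((a.1 : ℂ) * z) * derivative f with hg
    have hgk : ∀ k, g.coeff k = a.2 * (d + 1 - k) * f.coeff k +
        a.1 * z * ((k + 1) * f.coeff (k + 1)) := by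
      intro k
      rw [hg, coeff_add, coeff_C_mul, coeff_sub, coeff_C_mul, coeff_C_mul, coeff_derivative]
      rcases k with _ | k
      · simp; ring
      · rw [coeff_X_mul, coeff_derivative]; push_cast; ring
    have hgd : g.natDegree ≤ d := by
      refine natDegree_le_iff_coeff_eq_zero.2 fun k hk => ?_
      rw [hgk, coeff_eq_zero_of_natDegree_lt (p := f) (n := k + 1) (by omega)]
      rcases eq_or_lt_of_le (Nat.succ_le_of_lt hk) with rfl | hk'
      · push_cast; ring
      · rw [coeff_eq_zero_of_natDegree_lt (p := f) (n := k) (by omega)]; ring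
    have hgz : ∀ w : ℂ, 0 < w.im → g.eval w ≠ 0 := by
      intro w hw
      have hζ : 0 < ((a.1 / a.2 : ℝ) * z : ℂ).im := by
        rw [Complex.im_ofReal_mul]
        positivity
      have h := polar_derivative_ne_zero (Nat.succ_ne_zero d) hfd hf hw hζ
      have h2 : g.eval w = a.2 * (((d + 1 : ℕ) : ℂ) * f.eval w +
          ((a.1 / a.2 : ℝ) * z - w) * f.derivative.eval w) := by
        have : (a.2 : ℂ) ≠ 0 := Complex.ofReal_ne_zero.2 ht.ne'
        simp [hg]
        field_simp
        ring
      rw [h2]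
      exact mul_ne_zero (Complex.ofReal_ne_zero.2 ht.ne') h
    have hmain := ih (fun b hb => hs b (Multiset.mem_cons_of_mem hb)) hgd hgz
    rw [Multiset.card_cons, Multiset.map_cons, Multiset.prod_cons, ← hQ, ← hd]
    intro h0
    apply hmain
    have hP : ∀ k, ((C a.1 * X + C a.2) * Q).coeff k =
        (if k = 0 then 0 else a.1 * Q.coeff (k - 1)) + a.2 * Q.coeff k := by
      intro k
      rw [add_mul, coeff_add, coeff_C_mul, mul_assoc, coeff_C_mul]
      rcases k with _ | k
      · simp
      · simp [coeff_X_mul]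
    -- Both sums agree after the terms in `f.coeff (k + 1)` are reindexed.
    have e1 : ∀ k ∈ Finset.range (d + 1),
        ((Q.coeff k / (d.choose k : ℝ) : ℝ) : ℂ) * g.coeff k * z ^ k =
          (d + 1) * (((a.2 * Q.coeff k / ((d + 1).choose k : ℝ) : ℝ) : ℂ) * f.coeff k * z ^ k) +
          (d + 1) * (((a.1 * Q.coeff k / ((d + 1).choose (k + 1) : ℝ) : ℝ) : ℂ) *
            f.coeff (k + 1) * z ^ (k + 1)) := by
      intro k hk
      have hkd : k ≤ d := Nat.lt_succ_iff.1 (Finset.mem_range.1 hk)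
      have c0 : ((d.choose k : ℕ) : ℂ) ≠ 0 := Nat.cast_ne_zero.2 (Nat.choose_pos hkd).ne'
      have c1 : (((d + 1).choose k : ℕ) : ℂ) ≠ 0 :=
        Nat.cast_ne_zero.2 (Nat.choose_pos (hkd.trans d.le_succ)).ne'
      have c2 : (((d + 1).choose (k + 1) : ℕ) : ℂ) ≠ 0 :=
        Nat.cast_ne_zero.2 (Nat.choose_pos (Nat.succ_le_succ hkd)).ne'
      have i1 : (((d + 1).choose k : ℕ) : ℂ) * (d + 1 - k) = (d + 1) * (d.choose k : ℕ) := by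
        have h := Nat.choose_mul_succ_eq d k
        have h' : (((d + 1 - k : ℕ)) : ℂ) = d + 1 - k := by
          rw [Nat.cast_sub (hkd.trans d.le_succ)]; push_cast; ring
        rw [← h', mul_comm ((d : ℂ) + 1)]
        exact_mod_cast h.symm
      have i2 : ((d : ℂ) + 1) * (d.choose k : ℕ) = ((d + 1).choose (k + 1) : ℕ) * (k + 1) := by
        exact_mod_cast Nat.add_one_mul_choose_eq d k
      have j1 : ((d : ℂ) + 1 - k) / (d.choose k : ℕ) = (d + 1) / ((d + 1).choose k : ℕ) := by
        rw [div_eq_div_iff c0 c1]; linear_combination i1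
      have j2 : ((k : ℂ) + 1) / (d.choose k : ℕ) = (d + 1) / ((d + 1).choose (k + 1) : ℕ) := by
        rw [div_eq_div_iff c0 c2]; linear_combination -i2
      rw [hgk]
      push_cast
      linear_combination (a.2 : ℂ) * Q.coeff k * f.coeff k * z ^ k * j1 +
        (a.1 : ℂ) * Q.coeff k * f.coeff (k + 1) * z ^ (k + 1) * j2
    rw [Finset.sum_congr rfl e1, Finset.sum_add_distrib, ← Finset.mul_sum, ← Finset.mul_sum,
      ← mul_add]
    refine mul_eq_zero_of_right _ ?_
    rw [← h0]
    have e2 : ∀ k, (((C a.1 * X + C a.2) * Q).coeff k / ((d + 1).choose k : ℝ) : ℝ) =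
        (if k = 0 then 0 else a.1 * Q.coeff (k - 1)) / ((d + 1).choose k : ℝ) +
          a.2 * Q.coeff k / ((d + 1).choose k : ℝ) := fun k => by rw [hP, add_div]
    simp only [e2]
    simp only [Complex.ofReal_add, add_mul, Finset.sum_add_distrib]
    rw [add_comm]
    congr 1
    · rw [Finset.sum_range_succ' _ (d + 1)]
      simp
    · rw [Finset.sum_range_succ _ (d + 1), hQd]
      simp

/-! ### Hurwitz's theorem for polynomials of bounded degree -/

open Polynomial in
/-- Quantitative form of the nonvanishing near `0`: each zero of `p` is at distance at least `ρ`, so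
each linear factor grows by at most `1 + 1 / ρ` between `0` and `1`. -/
theorem norm_eval_one_le {p : ℂ[X]} {D : ℕ} (hp : p.natDegree ≤ D) {ρ : ℝ} (hρ : 0 < ρ)
    (h : ∀ t : ℂ, ‖t‖ < ρ → p.eval t ≠ 0) :
    ‖p.eval 1‖ ≤ ‖p.eval 0‖ * (1 + 1 / ρ) ^ D := by
  have key : ∀ m : Multiset ℂ, (∀ a ∈ m, ρ ≤ ‖a‖) →
      ‖(m.map (1 - ·)).prod‖ ≤ ‖(m.map (0 - ·)).prod‖ * (1 + 1 / ρ) ^ m.card := by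
    intro m
    induction m using Multiset.induction_on with
    | empty => simp
    | cons a m ih =>
      intro hm
      have ha := hm a (Multiset.mem_cons_self a m)
      have h2 := ih fun b hb => hm b (Multiset.mem_cons_of_mem hb)
      rw [Multiset.map_cons, Multiset.map_cons, Multiset.prod_cons, Multiset.prod_cons,
        Multiset.card_cons, norm_mul, norm_mul, pow_succ]
      have h3 : ‖1 - a‖ ≤ ‖0 - a‖ * (1 + 1 / ρ) := by
        have h4 : 1 ≤ ‖a‖ * (1 / ρ) := by
          rw [mul_one_div]; exact (one_le_div hρ).2 ha
        have h5 : ‖1 - a‖ ≤ 1 + ‖a‖ := by simpa using norm_sub_le (1 : ℂ) a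
        rw [zero_sub, norm_neg]
        linarith
      calc _ ≤ (‖0 - a‖ * (1 + 1 / ρ)) * (‖(m.map (0 - ·)).prod‖ * (1 + 1 / ρ) ^ m.card) :=
            mul_le_mul h3 h2 (norm_nonneg _) (by positivity)
        _ = _ := by ring
  have hs := IsAlgClosed.splits p
  rw [hs.eval_eq_prod_roots, hs.eval_eq_prod_roots, norm_mul, norm_mul, mul_assoc]
  refine mul_le_mul_of_nonneg_left ?_ (norm_nonneg _)
  refine (key p.roots fun a ha => ?_).trans ?_
  · by_contra hlt
    exact h a (not_le.1 hlt) (isRoot_of_mem_roots ha)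
  · refine mul_le_mul_of_nonneg_left ?_ (norm_nonneg _)
    exact pow_le_pow_right₀ (by simp [hρ.le]) ((card_roots' p).trans hp)

open Polynomial in
/-- Harnack-type inequality for stable polynomials: the growth away from a point of the upper
half-space is bounded in terms of the degree alone. -/
theorem exists_norm_evalC_le {n : ℕ} (D : ℕ) {z : Fin n → ℂ} (hz : ∀ j, 0 < (z j).im)
    (w : Fin n → ℂ) : ∃ K : ℝ, ∀ f : MvPolynomial (Fin n) ℝ, f.totalDegree ≤ D →
      IsRealStable f → ‖evalC w f‖ ≤ ‖evalC z f‖ * K := by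
  have hopen : IsOpen {t : ℂ | ∀ j, 0 < (z j + t * (w j - z j)).im} := by
    rw [Set.ofPred_forall]
    exact isOpen_iInter_of_finite fun j => isOpen_lt continuous_const (by fun_prop)
  obtain ⟨ρ, hρ, hball⟩ := Metric.isOpen_iff.1 hopen 0 (by simpa using hz)
  refine ⟨(1 + 1 / ρ) ^ D, fun f hfD hf => ?_⟩
  set L : Fin n → ℂ[X] := fun j => C (w j - z j) * X + C (z j) with hL
  set p : ℂ[X] := MvPolynomial.aeval L (MvPolynomial.map (algebraMap ℝ ℂ) f) with hp
  have hpt : ∀ t : ℂ, p.eval t = evalC (fun j => z j + t * (w j - z j)) f := by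
    intro t
    rw [hp, evalC, MvPolynomial.aeval_map_algebraMap, ← coe_aeval_eq_eval,
      ← AlgHom.restrictScalars_apply ℝ (aeval t), MvPolynomial.comp_aeval_apply]
    congr 1
    congr 1
    funext j
    simp [hL]
    ring
  have hpD : p.natDegree ≤ D := by
    refine (MvPolynomial.aeval_natDegree_le (m := D) (n := 1) _ ?_ L
      fun j => natDegree_linear_le).trans (mul_one D).le
    exact (Finset.sup_mono (MvPolynomial.support_map_subset _ _)).trans hfD
  have h := norm_eval_one_le hpD hρ fun t ht => by
    rw [hpt]
    exact isRealStable_iff.1 hf _ (hball (by simpa using ht))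
  rw [hpt, hpt] at h
  simpa using h

/-- **Hurwitz's theorem** for polynomials of bounded degree: a pointwise limit of real stable
polynomials is real stable or zero. -/
theorem isRealStable_or_eq_zero_of_tendsto {n D : ℕ} {F : ℕ → MvPolynomial (Fin n) ℝ}
    {f : MvPolynomial (Fin n) ℝ} (hD : ∀ m, (F m).totalDegree ≤ D) (hF : ∀ m, IsRealStable (F m))
    (hlim : ∀ z : Fin n → ℂ,
      Filter.Tendsto (fun m => evalC z (F m)) Filter.atTop (nhds (evalC z f))) :
    IsRealStable f ∨ f = 0 := by
  by_cases hf : IsRealStable f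
  · exact Or.inl hf
  right
  rw [isRealStable_iff] at hf
  push Not at hf
  obtain ⟨z, hz, hz0⟩ := hf
  have hw : ∀ w, evalC w f = 0 := by
    intro w
    obtain ⟨K, hK⟩ := exists_norm_evalC_le D hz w
    have h := le_of_tendsto_of_tendsto (hlim w).norm ((hlim z).norm.mul_const K)
      (Filter.Eventually.of_forall fun m => hK (F m) (hD m) (hF m))
    rw [hz0, norm_zero, zero_mul] at h
    exact norm_le_zero_iff.1 h
  refine MvPolynomial.funext fun x => ?_
  have h := hw fun i => (x i : ℂ)
  rw [map_zero]
  refine Complex.ofReal_injective ?_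
  rw [Complex.ofReal_zero, ← h, evalC]
  exact (MvPolynomial.aeval_algebraMap_apply (A := ℝ) ℂ x f).symm

/-! ### Products of nonnegative multiplier sequences -/

theorem totalDegree_diagonalOperator_le {n : ℕ} (lam : (Fin n → ℕ) → ℝ)
    (f : MvPolynomial (Fin n) ℝ) : (diagonalOperator lam f).totalDegree ≤ f.totalDegree := by
  refine Finset.sup_mono fun α hα => ?_
  rw [MvPolynomial.mem_support_iff, coeff_diagonalOperator] at hα
  exact MvPolynomial.mem_support_iff.2 (right_ne_zero_of_mul hα)

theorem le_totalDegree_of_mem_support {n : ℕ} {f : MvPolynomial (Fin n) ℝ} {α : Fin n →₀ ℕ}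
    (hα : α ∈ f.support) (i : Fin n) : α i ≤ f.totalDegree :=
  (Finsupp.le_degree i α).trans (MvPolynomial.le_totalDegree hα)

open Polynomial in
/-- A real stable polynomial restricted to one complex variable, the others being fixed. -/
theorem exists_univariate_restriction {n : ℕ} (f : MvPolynomial (Fin n) ℝ) (z : Fin n → ℂ)
    (i : Fin n) : ∃ q : ℂ[X], q.natDegree ≤ f.totalDegree ∧
      (∀ w, q.eval w = evalC (Function.update z i w) f) ∧
      ∀ (d : ℕ) (mu : ℕ → ℝ), f.totalDegree ≤ d →
        evalC z (diagonalOperator (fun α => mu (α i)) f) =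
        ∑ k ∈ Finset.range (d + 1), (mu k : ℂ) * q.coeff k * z i ^ k := by
  set c : (Fin n →₀ ℕ) → ℂ := fun α =>
    ((MvPolynomial.coeff α f : ℝ) : ℂ) * ∏ j ∈ Finset.univ.erase i, z j ^ α j with hc
  have hprod : ∀ (α : Fin n →₀ ℕ) (w : ℂ), ∏ j, Function.update z i w j ^ α j =
      w ^ α i * ∏ j ∈ Finset.univ.erase i, z j ^ α j := by
    intro α w
    rw [← Finset.mul_prod_erase _ _ (Finset.mem_univ i), Function.update_self]
    congr 1
    refine Finset.prod_congr rfl fun j hj => ?_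
    rw [Function.update_of_ne (Finset.ne_of_mem_erase hj)]
  have hprod' : ∀ α : Fin n →₀ ℕ, ∏ j, z j ^ α j =
      z i ^ α i * ∏ j ∈ Finset.univ.erase i, z j ^ α j := fun α =>
    (Finset.mul_prod_erase _ _ (Finset.mem_univ i)).symm
  refine ⟨∑ α ∈ f.support, monomial (α i) (c α), ?_, ?_, ?_⟩
  · refine natDegree_sum_le_of_forall_le _ _ fun α hα => ?_
    exact (natDegree_monomial_le _).trans (le_totalDegree_of_mem_support hα i)
  · intro w
    rw [eval_finsetSum, evalC_eq_sum]
    refine Finset.sum_congr rfl fun α _ => ?_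
    rw [eval_monomial, hprod, hc]
    ring
  · intro d mu hd
    rw [evalC_diagonalOperator]
    simp only [finsetSum_coeff, coeff_monomial, Finset.mul_sum, Finset.sum_mul]
    rw [Finset.sum_comm]
    refine Finset.sum_congr rfl fun α hα => ?_
    rw [Finset.sum_eq_single (α i)]
    · rw [if_pos rfl, hprod', hc]
      ring
    · intro k _ hk
      rw [if_neg hk.symm]
      ring
    · intro h
      exact absurd (Finset.mem_range.2 (Nat.lt_succ_of_le
        ((le_totalDegree_of_mem_support hα i).trans hd))) h

open Polynomial in
/-- Schur–Szegő composition in one variable with a product of linear forms with positive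
coefficients preserves real stability. -/
theorem isRealStable_diagonalOperator_of_linear_factors {n : ℕ} {f : MvPolynomial (Fin n) ℝ}
    (hf : IsRealStable f) (i : Fin n) (s : Multiset (ℝ × ℝ)) (hs : ∀ a ∈ s, 0 < a.1 ∧ 0 < a.2)
    (hd : f.totalDegree ≤ s.card) :
    IsRealStable (diagonalOperator (fun α =>
      (s.map fun a : ℝ × ℝ => C a.1 * X + C a.2).prod.coeff (α i) / (s.card.choose (α i) : ℝ))
        f) := by
  rw [isRealStable_iff] at hf ⊢
  intro z hz
  obtain ⟨q, hqd, hqe, hqT⟩ := exists_univariate_restriction f z i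
  have hT := hqT s.card (fun k =>
    (s.map fun a : ℝ × ℝ => C a.1 * X + C a.2).prod.coeff k / (s.card.choose k : ℝ)) hd
  beta_reduce at hT
  rw [hT]
  refine schur_szego_ne_zero s hs (hqd.trans hd) (fun w hw => ?_) (hz i)
  rw [hqe]
  refine hf _ fun j => ?_
  rcases eq_or_ne j i with rfl | hj
  · rwa [Function.update_self]
  · rw [Function.update_of_ne hj]; exact hz j

open Polynomial in
theorem continuous_coeff_linear_factors (s : Multiset (ℝ × ℝ)) (k : ℕ) :
    Continuous fun ε : ℝ =>
      ((s.map fun a : ℝ × ℝ => C (a.1 + ε) * X + C (a.2 + ε)).prod.coeff k) := by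
  induction s using Multiset.induction_on generalizing k with
  | empty => simpa using continuous_const
  | cons a s ih =>
    simp only [Multiset.map_cons, Multiset.prod_cons, add_mul, coeff_add, coeff_C_mul, mul_assoc]
    refine Continuous.add ?_ (by have := ih k; fun_prop)
    rcases k with _ | k
    · simpa using continuous_const
    · simp only [coeff_X_mul]
      have := ih k
      fun_prop

open Polynomial in
/-- A hyperbolic polynomial with nonnegative coefficients is a product of linear forms with
nonnegative coefficients. Factors `0 * X + 1` make up for a small degree. -/
theorem exists_linear_factors {P : ℝ[X]} (hP : IsHyperbolic P) (hc : ∀ k, 0 ≤ P.coeff k) {d : ℕ}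
    (hd : P.natDegree ≤ d) : ∃ s : Multiset (ℝ × ℝ), s.card = d ∧ (∀ a ∈ s, 0 ≤ a.1 ∧ 0 ≤ a.2) ∧
      P = C P.leadingCoeff * (s.map fun a : ℝ × ℝ => C a.1 * X + C a.2).prod := by
  have hsplit : P.Splits := by
    refine Splits.of_splits_map (algebraMap ℝ ℂ) (IsAlgClosed.splits _) fun a ha => ?_
    have h := hP.2 a (by
      have := isRoot_of_mem_roots ha
      rwa [IsRoot.def, eval_map_algebraMap] at this)
    exact ⟨a.re, Complex.ext rfl (by simp [h])⟩
  have hroot : ∀ a ∈ P.roots, a ≤ 0 := by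
    intro a ha
    by_contra hlt
    push Not at hlt
    have h0 : P.eval a = 0 := isRoot_of_mem_roots ha
    rw [eval_eq_sum_range, Finset.sum_eq_zero_iff_of_nonneg
      (fun k _ => mul_nonneg (hc k) (pow_nonneg hlt.le k))] at h0
    have h1 := h0 P.natDegree (Finset.self_mem_range_succ _)
    rcases mul_eq_zero.1 h1 with h | h
    · exact hP.1 (leadingCoeff_eq_zero.1 h)
    · exact (pow_pos hlt _).ne' h
  have hcard : P.roots.card = P.natDegree := hsplit.natDegree_eq_card_roots.symm
  refine ⟨P.roots.map (fun a => ((1 : ℝ), -a)) +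
    Multiset.replicate (d - P.natDegree) ((0 : ℝ), (1 : ℝ)), ?_, ?_, ?_⟩
  · rw [Multiset.card_add, Multiset.card_map, Multiset.card_replicate, hcard]
    omega
  · intro a ha
    rcases Multiset.mem_add.1 ha with ha | ha
    · obtain ⟨b, hb, rfl⟩ := Multiset.mem_map.1 ha
      exact ⟨zero_le_one, neg_nonneg.2 (hroot b hb)⟩
    · rw [Multiset.eq_of_mem_replicate ha]
      exact ⟨le_rfl, zero_le_one⟩
  · conv_lhs => rw [hsplit.eq_prod_roots]
    simp [Multiset.map_map, sub_eq_add_neg]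

open Polynomial in
/-- A nonnegative multiplier sequence acting on one variable preserves real stability. -/
theorem diagonalOperator_single_variable {n : ℕ} {mu : ℕ → ℝ} (hmu : IsMultiplierSequence mu)
    (h0 : ∀ k, 0 ≤ mu k) (i : Fin n) :
    IsMultivariateMultiplierSequence (fun α : Fin n → ℕ => mu (α i)) := by
  intro f hf
  set d := f.totalDegree with hd
  set P : ℝ[X] := univariateDiagonalOperator mu ((X + 1) ^ d) with hP
  have hPk : ∀ k, P.coeff k = mu k * d.choose k := fun k => by
    rw [hP, coeff_univariateDiagonalOperator, coeff_X_add_one_pow]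
  have hhyp : IsHyperbolic ((X + 1 : ℝ[X]) ^ d) := by
    rw [isHyperbolic_iff]
    intro z hz
    rw [map_pow]
    refine pow_ne_zero _ fun h => ?_
    have h' := congrArg Complex.im h
    simp at h'
    exact hz.ne' h'
  rcases hmu _ hhyp with hPh | hP0
  · have hPd : P.natDegree ≤ d := natDegree_le_iff_coeff_eq_zero.2 fun k hk => by
      rw [hPk, Nat.choose_eq_zero_of_lt hk]; simp
    obtain ⟨s, hcard, hs, hPs⟩ := exists_linear_factors hPh
      (fun k => by rw [← hP, hPk]; exact mul_nonneg (h0 k) (Nat.cast_nonneg _)) hPd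
    rw [← hP] at hPs
    have hlead : P.leadingCoeff ≠ 0 := leadingCoeff_ne_zero.2 hPh.1
    -- The linear factors are moved into the open quadrant by `ε = 1 / (m + 1)`.
    set G : ℝ → ℕ → ℝ := fun ε k =>
      (s.map fun a : ℝ × ℝ => C (a.1 + ε) * X + C (a.2 + ε)).prod.coeff k / (d.choose k : ℝ)
      with hG
    have hstab : ∀ ε : ℝ, 0 < ε →
        IsRealStable (diagonalOperator (fun α : Fin n → ℕ => G ε (α i)) f) := by
      intro ε hε
      have h := isRealStable_diagonalOperator_of_linear_factors hf i
        (s.map fun a => (a.1 + ε, a.2 + ε)) (fun b hb => by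
          obtain ⟨a, ha, rfl⟩ := Multiset.mem_map.1 hb
          exact ⟨add_pos_of_nonneg_of_pos (hs a ha).1 hε,
            add_pos_of_nonneg_of_pos (hs a ha).2 hε⟩)
        (by rw [Multiset.card_map, hcard])
      simpa only [Multiset.map_map, Multiset.card_map, hcard, Function.comp_def] using h
    have hlim : IsRealStable (diagonalOperator (fun α : Fin n → ℕ => G 0 (α i)) f) ∨
        diagonalOperator (fun α : Fin n → ℕ => G 0 (α i)) f = 0 := by
      refine isRealStable_or_eq_zero_of_tendsto (D := d)
        (F := fun m : ℕ => diagonalOperator (fun α : Fin n → ℕ => G (1 / ((m : ℝ) + 1)) (α i)) f)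
        (fun m => totalDegree_diagonalOperator_le _ f)
        (fun m => hstab _ (by positivity)) fun z => ?_
      have hcont : Continuous fun ε : ℝ =>
          evalC z (diagonalOperator (fun α : Fin n → ℕ => G ε (α i)) f) := by
        simp only [evalC_diagonalOperator]
        refine continuous_finsetSum _ fun α _ => ?_
        have hGc : Continuous fun ε => G ε (α i) :=
          (continuous_coeff_linear_factors s (α i)).div_const _
        fun_prop
      exact (hcont.tendsto 0).comp tendsto_one_div_add_atTop_nhds_zero_nat
    have heq : diagonalOperator (fun α : Fin n → ℕ => mu (α i)) f =
        P.leadingCoeff • diagonalOperator (fun α : Fin n → ℕ => G 0 (α i)) f := by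
      ext α
      rw [MvPolynomial.coeff_smul, coeff_diagonalOperator, coeff_diagonalOperator, smul_eq_mul,
        ← mul_assoc]
      by_cases hα : α ∈ f.support
      · have hle : α i ≤ d := le_totalDegree_of_mem_support hα i
        have hch : (d.choose (α i) : ℝ) ≠ 0 := Nat.cast_ne_zero.2 (Nat.choose_pos hle).ne'
        congr 1
        have h1 := hPk (α i)
        rw [hPs, coeff_C_mul] at h1
        simp only [hG, add_zero]
        rw [← mul_div_assoc, h1, mul_div_cancel_right₀ _ hch]
      · rw [MvPolynomial.notMem_support_iff.1 hα]; ring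
    rw [heq]
    rcases hlim with h | h
    · left
      rw [isRealStable_iff] at h ⊢
      intro z hz
      rw [map_smul, Complex.real_smul]
      exact mul_ne_zero (Complex.ofReal_ne_zero.2 hlead) (h z hz)
    · right
      rw [h, smul_zero]
  · right
    ext α
    rw [coeff_diagonalOperator, MvPolynomial.coeff_zero]
    by_cases hα : α ∈ f.support
    · have hle : α i ≤ d := le_totalDegree_of_mem_support hα i
      have h1 := hPk (α i)
      rw [hP, hP0, coeff_zero] at h1
      rcases mul_eq_zero.1 h1.symm with h | h
      · rw [h, zero_mul]
      · exact absurd (Nat.cast_eq_zero.1 h) (Nat.choose_pos hle).ne'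
    · rw [MvPolynomial.notMem_support_iff.1 hα, mul_zero]

theorem neg_one_pow_mul_self (m : ℕ) : (-1 : ℝ) ^ m * (-1) ^ m = 1 := by
  rw [← mul_pow]; simp

theorem IsMultivariateMultiplierSequence.mul {n : ℕ} {lam mu : (Fin n → ℕ) → ℝ}
    (hl : IsMultivariateMultiplierSequence lam) (hm : IsMultivariateMultiplierSequence mu) :
    IsMultivariateMultiplierSequence fun α => lam α * mu α := by
  intro f hf
  rw [← diagonalOperator_comp]
  rcases hm f hf with h | h
  · exact hl _ h
  · right
    rw [h, map_zero]

theorem isMultivariateMultiplierSequence_const {n : ℕ} (c : ℝ) :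
    IsMultivariateMultiplierSequence fun _ : Fin n → ℕ => c := by
  intro f hf
  have h : diagonalOperator (fun _ => c) f = c • f := by
    ext α
    rw [coeff_diagonalOperator, MvPolynomial.coeff_smul, smul_eq_mul]
  rw [h]
  rcases eq_or_ne c 0 with rfl | hc
  · exact Or.inr (zero_smul _ _)
  · left
    rw [isRealStable_iff] at hf ⊢
    intro z hz
    rw [map_smul, Complex.real_smul]
    exact mul_ne_zero (Complex.ofReal_ne_zero.2 hc) (hf z hz)

theorem isMultivariateMultiplierSequence_prod {n : ℕ} {nu : Fin n → ℕ → ℝ}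
    (h : ∀ i, IsMultiplierSequence (nu i)) (h0 : ∀ i k, 0 ≤ nu i k) :
    IsMultivariateMultiplierSequence fun α : Fin n → ℕ => ∏ i, nu i (α i) := by
  have key : ∀ s : Finset (Fin n),
      IsMultivariateMultiplierSequence fun α : Fin n → ℕ => ∏ i ∈ s, nu i (α i) := by
    intro s
    induction s using Finset.induction_on with
    | empty => simpa using isMultivariateMultiplierSequence_const 1
    | insert i s hi ih =>
      simp only [Finset.prod_insert hi]
      exact (diagonalOperator_single_variable (h i) (h0 i) i).mul ih
  exact key Finset.univ

/-- The substitution `z ↦ -z` preserves real stability because zeros come in conjugate pairs. -/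
theorem evalC_neg_ne_zero {n : ℕ} {f : MvPolynomial (Fin n) ℝ} (hf : IsRealStable f)
    {z : Fin n → ℂ} (hz : ∀ j, 0 < (z j).im) : evalC (-z) f ≠ 0 := by
  intro h
  refine isRealStable_iff.1 hf (fun j => starRingEnd ℂ (-z j)) (by simpa using hz) ?_
  have h1 := congrArg (starRingEnd ℂ) h
  rw [map_zero, evalC_eq_sum, map_sum] at h1
  rw [evalC_eq_sum, ← h1]
  refine Finset.sum_congr rfl fun α _ => ?_
  simp

theorem isMultivariateMultiplierSequence_neg_one_pow {n : ℕ} :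
    IsMultivariateMultiplierSequence fun α : Fin n → ℕ => (-1 : ℝ) ^ ∑ i, α i := by
  intro f hf
  left
  rw [isRealStable_iff]
  intro z hz
  convert evalC_neg_ne_zero hf hz using 1
  rw [evalC_diagonalOperator, evalC_eq_sum]
  refine Finset.sum_congr rfl fun α _ => ?_
  have : ∏ i, (-z) i ^ α i = (-1) ^ (∑ i, α i) * ∏ i, z i ^ α i := by
    rw [← Finset.prod_pow_eq_pow_sum, ← Finset.prod_mul_distrib]
    refine Finset.prod_congr rfl fun i _ => ?_
    rw [Pi.neg_apply, neg_pow]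
  rw [this]
  push_cast
  ring

theorem IsMultiplierSequence.const_mul {mu : ℕ → ℝ} (hmu : IsMultiplierSequence mu) (c : ℝ) :
    IsMultiplierSequence fun k => c * mu k := by
  intro p hp
  have h : univariateDiagonalOperator (fun k => c * mu k) p =
      c • univariateDiagonalOperator mu p := by
    ext k
    rw [Polynomial.coeff_smul, coeff_univariateDiagonalOperator, coeff_univariateDiagonalOperator,
      smul_eq_mul, mul_assoc]
  rw [h]
  rcases eq_or_ne c 0 with rfl | hc
  · exact Or.inr (zero_smul _ _)
  rcases hmu p hp with h | h
  · left
    rw [isHyperbolic_iff] at h ⊢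
    intro z hz
    rw [map_smul, Complex.real_smul]
    exact mul_ne_zero (Complex.ofReal_ne_zero.2 hc) (h z hz)
  · right
    rw [h, smul_zero]

theorem IsMultiplierSequence.neg_one_pow_mul {mu : ℕ → ℝ} (hmu : IsMultiplierSequence mu) :
    IsMultiplierSequence fun k => (-1) ^ k * mu k := by
  intro p hp
  have h : univariateDiagonalOperator (fun k => (-1) ^ k * mu k) p =
      (univariateDiagonalOperator mu p).comp (Polynomial.C (-1) * Polynomial.X) := by
    ext k
    rw [Polynomial.comp_C_mul_X_coeff, coeff_univariateDiagonalOperator,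
      coeff_univariateDiagonalOperator]
    ring
  rw [h]
  rcases hmu p hp with h | h
  · left
    rw [isHyperbolic_iff]
    intro z hz h0
    rw [Polynomial.aeval_comp] at h0
    have h1 := h.2 _ h0
    simp at h1
    exact hz.ne' h1
  · right
    rw [h, Polynomial.zero_comp]

/-- Multiplier sequences in the separate variables whose product has constant or alternating sign
give a multivariate multiplier sequence. -/
theorem isMultivariateMultiplierSequence_of_factorization {n : ℕ} {lam : (Fin n → ℕ) → ℝ}
    {mu : Fin n → ℕ → ℝ} (hmu : ∀ i, IsMultiplierSequence (mu i))
    (hlam : ∀ α, lam α = ∏ i, mu i (α i))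
    (hsign : (∀ α β : Fin n → ℕ, 0 ≤ lam α * lam β) ∨
      (∀ α β : Fin n → ℕ, 0 ≤ (-1 : ℝ) ^ ((∑ i, α i) + (∑ i, β i)) * (lam α * lam β))) :
    IsMultivariateMultiplierSequence lam := by
  by_cases hex : ∃ α, lam α ≠ 0
  swap
  · push Not at hex
    rw [show lam = fun _ => 0 from funext hex]
    exact isMultivariateMultiplierSequence_const 0
  obtain ⟨α, hα⟩ := hex
  have hne : ∀ i, mu i (α i) ≠ 0 := by
    rw [hlam] at hα
    exact fun i => Finset.prod_ne_zero_iff.1 hα i (Finset.mem_univ i)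
  set c : ℝ := (∏ i, mu i (α i))⁻¹ with hc
  have hpos : ∀ i, 0 < ∏ j ∈ Finset.univ.erase i, (mu j (α j)) ^ 2 := fun i =>
    Finset.prod_pos fun j _ => sq_pos_of_ne_zero (hne j)
  have hupd : ∀ i k, lam (Function.update α i k) * lam α =
      (mu i (α i) * mu i k) * ∏ j ∈ Finset.univ.erase i, (mu j (α j)) ^ 2 := by
    intro i k
    rw [hlam, hlam, ← Finset.mul_prod_erase _ _ (Finset.mem_univ i),
      ← Finset.mul_prod_erase _ (fun j => mu j (α j)) (Finset.mem_univ i), Function.update_self,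
      Finset.prod_pow]
    rw [Finset.prod_congr rfl fun j hj => by
      rw [Function.update_of_ne (Finset.ne_of_mem_erase hj)]]
    ring
  rcases hsign with hs | hs
  · have h := (isMultivariateMultiplierSequence_const c).mul
      (isMultivariateMultiplierSequence_prod (fun i => (hmu i).const_mul (mu i (α i)))
        fun i k => by
          have h1 := hs (Function.update α i k) α
          rw [hupd] at h1
          exact nonneg_of_mul_nonneg_left h1 (hpos i))
    convert h using 2 with β
    rw [hlam, Finset.prod_mul_distrib, hc, inv_mul_cancel_left₀ (hlam α ▸ hα)]
  · have h := ((isMultivariateMultiplierSequence_const (c * (-1) ^ (∑ i, α i))).mul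
      isMultivariateMultiplierSequence_neg_one_pow).mul
      (isMultivariateMultiplierSequence_prod
        (fun i => ((hmu i).neg_one_pow_mul).const_mul ((-1) ^ (α i) * mu i (α i)))
        fun i k => by
          have h1 := hs (Function.update α i k) α
          rw [hupd, ← mul_assoc] at h1
          have h2 := nonneg_of_mul_nonneg_left h1 (hpos i)
          have h3 : ((-1 : ℝ)) ^ ((∑ j, Function.update α i k j) + ∑ j, α j) =
              (-1) ^ (α i) * (-1) ^ k := by
            rw [← Finset.add_sum_erase _ _ (Finset.mem_univ i),
              ← Finset.add_sum_erase _ α (Finset.mem_univ i), Function.update_self]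
            rw [Finset.sum_congr rfl fun j hj => by
              rw [Function.update_of_ne (Finset.ne_of_mem_erase hj)]]
            simp only [pow_add]
            have := neg_one_pow_mul_self (∑ j ∈ Finset.univ.erase i, α j)
            linear_combination (-1 : ℝ) ^ k * (-1) ^ (α i) * this
          rw [h3] at h2
          linarith)
    convert h using 2 with β
    rw [hlam, Finset.prod_mul_distrib, Finset.prod_mul_distrib, Finset.prod_mul_distrib,
      Finset.prod_pow_eq_pow_sum, Finset.prod_pow_eq_pow_sum, hc]
    have e1 := neg_one_pow_mul_self (∑ j, α j)
    have e2 := neg_one_pow_mul_self (∑ j, β j)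
    have e3 : (∏ i, mu i (α i))⁻¹ * ∏ i, mu i (α i) = 1 := inv_mul_cancel₀ (hlam α ▸ hα)
    generalize ((-1 : ℝ) ^ ∑ j, α j) = u at *
    generalize ((-1 : ℝ) ^ ∑ j, β j) = v at *
    generalize ∏ i, mu i (α i) = x at *
    linear_combination (-∏ i, mu i (β i)) * (u * u * v * v * e3 + v * v * e1 + e2)

/-! ### Test polynomials -/

/-- The test polynomial with coefficient `c k` at the exponent `a k`. -/
noncomputable def testPolynomial {n : ℕ} {ι : Type*} (A : Finset ι) (a : ι → Fin n → ℕ)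
    (c : ι → ℝ) : MvPolynomial (Fin n) ℝ :=
  ∑ k ∈ A, MvPolynomial.monomial (Finsupp.equivFunOnFinite.symm (a k)) (c k)

theorem evalC_testPolynomial {n : ℕ} {ι : Type*} (A : Finset ι) (a : ι → Fin n → ℕ) (c : ι → ℝ)
    (z : Fin n → ℂ) :
    evalC z (testPolynomial A a c) = ∑ k ∈ A, (c k : ℂ) * ∏ i, z i ^ a k i := by
  rw [testPolynomial, map_sum]
  exact Finset.sum_congr rfl fun k _ => evalC_monomial z _ _

theorem diagonalOperator_testPolynomial {n : ℕ} {ι : Type*} (lam : (Fin n → ℕ) → ℝ)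
    (A : Finset ι) (a : ι → Fin n → ℕ) (c : ι → ℝ) :
    diagonalOperator lam (testPolynomial A a c) =
      testPolynomial A a fun k => lam (a k) * c k := by
  rw [testPolynomial, testPolynomial, map_sum]
  refine Finset.sum_congr rfl fun k _ => ?_
  ext α
  rw [coeff_diagonalOperator, MvPolynomial.coeff_monomial, MvPolynomial.coeff_monomial]
  split_ifs with h
  · subst h; rfl
  · rw [mul_zero]

theorem coeff_testPolynomial {n : ℕ} {ι : Type*} (A : Finset ι) {a : ι → Fin n → ℕ}
    (ha : Function.Injective a) (c : ι → ℝ) {k : ι} (hk : k ∈ A) :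
    MvPolynomial.coeff (Finsupp.equivFunOnFinite.symm (a k)) (testPolynomial A a c) = c k := by
  rw [testPolynomial, MvPolynomial.coeff_sum, Finset.sum_eq_single k]
  · rw [MvPolynomial.coeff_monomial, if_pos rfl]
  · intro l _ hl
    rw [MvPolynomial.coeff_monomial, if_neg fun h =>
      hl (ha (Finsupp.equivFunOnFinite.symm.injective h))]
  · exact fun h => absurd hk h

theorem IsMultivariateMultiplierSequence.test {n : ℕ} {lam : (Fin n → ℕ) → ℝ}
    (hlam : IsMultivariateMultiplierSequence lam) {ι : Type*} (A : Finset ι) (a : ι → Fin n → ℕ)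
    (c : ι → ℝ) (h : ∀ z : Fin n → ℂ, (∀ j, 0 < (z j).im) →
      ∑ k ∈ A, (c k : ℂ) * ∏ i, z i ^ a k i ≠ 0) :
    (∀ z : Fin n → ℂ, (∀ j, 0 < (z j).im) →
      ∑ k ∈ A, ((lam (a k) * c k : ℝ) : ℂ) * ∏ i, z i ^ a k i ≠ 0) ∨
    testPolynomial A a (fun k => lam (a k) * c k) = 0 := by
  have h1 : IsRealStable (testPolynomial A a c) := by
    rw [isRealStable_iff]
    intro z hz
    rw [evalC_testPolynomial]
    exact h z hz
  have h2 := hlam _ h1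
  rw [diagonalOperator_testPolynomial] at h2
  refine h2.imp (fun h3 z hz => ?_) id
  rw [← evalC_testPolynomial]
  exact isRealStable_iff.1 h3 z hz

theorem prod_pow_add_single {n : ℕ} (z : Fin n → ℂ) (x : Fin n → ℕ) (i : Fin n) :
    ∏ k, z k ^ (x + Pi.single i 1 : Fin n → ℕ) k = (∏ k, z k ^ x k) * z i := by
  simp only [Pi.add_apply, pow_add, Finset.prod_mul_distrib]
  congr 1
  rw [Finset.prod_eq_single i]
  · simp
  · intro j _ hj
    simp [Pi.single_eq_of_ne hj]
  · simp

/-- The effect of a multiplier sequence on a polynomial `p + q z_i + r z_j + s z_i z_j`. -/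
theorem IsMultivariateMultiplierSequence.test_four {n : ℕ} {lam : (Fin n → ℕ) → ℝ}
    (hlam : IsMultivariateMultiplierSequence lam) (x : Fin n → ℕ) (i j : Fin n) (p q r s : ℝ)
    (h : ∀ u v : ℂ, 0 < u.im → 0 < v.im → (i = j → u = v) →
      (p : ℂ) + q * u + r * v + s * (u * v) ≠ 0) :
    let P : ℂ → ℂ → ℂ := fun u v => ((p * lam x : ℝ) : ℂ) +
      ((q * lam (x + Pi.single i 1) : ℝ) : ℂ) * u + ((r * lam (x + Pi.single j 1) : ℝ) : ℂ) * v +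
      ((s * lam (x + Pi.single i 1 + Pi.single j 1) : ℝ) : ℂ) * (u * v)
    (∀ u v : ℂ, 0 < u.im → 0 < v.im → (i = j → u = v) → P u v ≠ 0) ∨
    (∀ u v : ℂ, 0 < u.im → 0 < v.im → (i = j → u = v) → P u v = 0) := by
  intro P
  set a : Fin 4 → Fin n → ℕ := ![x, x + Pi.single i 1, x + Pi.single j 1,
    x + Pi.single i 1 + Pi.single j 1] with ha
  have hpt : ∀ u v : ℂ, 0 < u.im → 0 < v.im → (i = j → u = v) →
      ∃ z : Fin n → ℂ, (∀ k, 0 < (z k).im) ∧ z i = u ∧ z j = v := by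
    intro u v hu hv huv
    refine ⟨Function.update (fun _ => v) i u, fun k => ?_, Function.update_self _ _ _, ?_⟩
    · rcases eq_or_ne k i with rfl | hk
      · rwa [Function.update_self]
      · rwa [Function.update_of_ne hk]
    · rcases eq_or_ne j i with rfl | hk
      · rw [Function.update_self, huv rfl]
      · rw [Function.update_of_ne hk]
  have key : ∀ (z : Fin n → ℂ) (p q r s : ℝ),
      ∑ k, (((![p, q, r, s] : Fin 4 → ℝ) k : ℝ) : ℂ) * ∏ l, z l ^ a k l =
        (∏ l, z l ^ x l) * (p + q * z i + r * z j + s * (z i * z j)) := by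
    intro z p q r s
    rw [Fin.sum_univ_four]
    simp only [ha, Matrix.cons_val, prod_pow_add_single]
    ring
  have hc : (fun k => lam (a k) * (![p, q, r, s] : Fin 4 → ℝ) k) =
      ![p * lam x, q * lam (x + Pi.single i 1), r * lam (x + Pi.single j 1),
        s * lam (x + Pi.single i 1 + Pi.single j 1)] := by
    funext k
    fin_cases k <;> simp [ha, mul_comm]
  have htest := hlam.test Finset.univ a ![p, q, r, s] fun z hz => by
    rw [key]
    exact mul_ne_zero (prod_pow_ne_zero hz x _) (h _ _ (hz i) (hz j) fun hij => by rw [hij])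
  rw [hc] at htest
  refine htest.imp ?_ ?_
  · intro h1 u v hu hv huv
    obtain ⟨z, hz, rfl, rfl⟩ := hpt u v hu hv huv
    have h2 := h1 z hz
    have h3 := key z (p * lam x) (q * lam (x + Pi.single i 1)) (r * lam (x + Pi.single j 1))
      (s * lam (x + Pi.single i 1 + Pi.single j 1))
    rw [← hc] at h3
    rw [h3] at h2
    exact right_ne_zero_of_mul h2
  · intro h1 u v hu hv huv
    obtain ⟨z, hz, rfl, rfl⟩ := hpt u v hu hv huv
    have h2 := congrArg (evalC z) h1
    rw [evalC_testPolynomial, map_zero, key] at h2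
    exact (mul_eq_zero.1 h2).resolve_left (prod_pow_ne_zero hz x _)

/-- A real stable bilinear polynomial `a + b u + c v + d u v` satisfies `a d ≤ b c`. -/
theorem bilinear_discriminant {a b c d : ℝ}
    (h : (∀ u v : ℂ, 0 < u.im → 0 < v.im → (a : ℂ) + b * u + c * v + d * (u * v) ≠ 0) ∨
      (∀ u v : ℂ, 0 < u.im → 0 < v.im → (a : ℂ) + b * u + c * v + d * (u * v) = 0)) :
    a * d ≤ b * c := by
  by_contra hlt
  push Not at hlt
  rcases h with h | h
  · -- The zero `v` of `a + b u + c v + d u v` for `u = i` lies in the upper half-plane.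
    have hn : 0 < c ^ 2 + d ^ 2 := by
      by_contra h0
      have hc : c = 0 := by nlinarith [sq_nonneg c, sq_nonneg d]
      have hd : d = 0 := by nlinarith [sq_nonneg c, sq_nonneg d]
      simp [hc, hd] at hlt
    refine h Complex.I ⟨-(a * c + b * d) / (c ^ 2 + d ^ 2), (a * d - b * c) / (c ^ 2 + d ^ 2)⟩
      (by simp) (div_pos (by linarith) hn) ?_
    apply Complex.ext
    · simp
      field_simp
      ring
    · simp
      field_simp
      ring
  · have h1 := h Complex.I Complex.I (by simp) (by simp)
    have h2 := h Complex.I (2 * Complex.I) (by simp) (by simp)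
    have r1 := congrArg Complex.re h1
    have r2 := congrArg Complex.re h2
    have i1 := congrArg Complex.im h1
    have i2 := congrArg Complex.im h2
    simp at r1 r2 i1 i2
    have hd : d = 0 := by linarith
    have hc : c = 0 := by linarith
    simp [hc, hd] at hlt

/-- The local minors vanish: both `(1 + z_i)(1 + z_j)` and `(1 + z_i)(1 - z_j)` are stable. -/
theorem IsMultivariateMultiplierSequence.minor {n : ℕ} {lam : (Fin n → ℕ) → ℝ}
    (hlam : IsMultivariateMultiplierSequence lam) (x : Fin n → ℕ) {i j : Fin n} (hij : i ≠ j) :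
    lam x * lam (x + Pi.single i 1 + Pi.single j 1) =
      lam (x + Pi.single i 1) * lam (x + Pi.single j 1) := by
  have ne : ∀ {u : ℂ} {t : ℝ}, 0 < u.im → u ≠ t := fun hu h => by simp [h] at hu
  have h1 := hlam.test_four x i j 1 1 1 1 fun u v hu hv _ => by
    have : ((1 : ℝ) : ℂ) + (1 : ℝ) * u + (1 : ℝ) * v + (1 : ℝ) * (u * v) =
      (u - (-1 : ℝ)) * (v - (-1 : ℝ)) := by push_cast; ring
    rw [this]
    exact mul_ne_zero (sub_ne_zero.2 (ne hu)) (sub_ne_zero.2 (ne hv))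
  have h2 := hlam.test_four x i j 1 1 (-1) (-1) fun u v hu hv _ => by
    have : ((1 : ℝ) : ℂ) + (1 : ℝ) * u + (-1 : ℝ) * v + (-1 : ℝ) * (u * v) =
      -((u - (-1 : ℝ)) * (v - (1 : ℝ))) := by push_cast; ring
    rw [this]
    exact neg_ne_zero.2 (mul_ne_zero (sub_ne_zero.2 (ne hu)) (sub_ne_zero.2 (ne hv)))
  have h1' := bilinear_discriminant (h1.imp
    (fun h u v hu hv => h u v hu hv fun e => absurd e hij)
    (fun h u v hu hv => h u v hu hv fun e => absurd e hij))
  have h2' := bilinear_discriminant (h2.imp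
    (fun h u v hu hv => h u v hu hv fun e => absurd e hij)
    (fun h u v hu hv => h u v hu hv fun e => absurd e hij))
  linarith

/-- The values at `x` and `x + e_i + e_j` have the same sign because `z_i z_j - 1` is stable,
also for `i = j`. -/
theorem IsMultivariateMultiplierSequence.two_step_nonneg {n : ℕ} {lam : (Fin n → ℕ) → ℝ}
    (hlam : IsMultivariateMultiplierSequence lam) (x : Fin n → ℕ) (i j : Fin n) :
    0 ≤ lam x * lam (x + Pi.single i 1 + Pi.single j 1) := by
  -- Products of two points of the upper half-plane avoid the positive real axis.
  have hmul : ∀ {u v : ℂ}, 0 < u.im → 0 < v.im → u * v ≠ 1 := by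
    intro u v hu hv h
    have hv' : v = u⁻¹ := by
      rw [eq_comm, inv_eq_iff_eq_inv]
      exact eq_inv_of_mul_eq_one_left h
    rw [hv', Complex.inv_im] at hv
    have : -u.im / Complex.normSq u ≤ 0 :=
      div_nonpos_of_nonpos_of_nonneg (by linarith) (Complex.normSq_nonneg u)
    linarith
  have h := hlam.test_four x i j (-1) 0 0 1 fun u v hu hv _ h0 => by
    refine hmul hu hv ?_
    push_cast at h0
    linear_combination h0
  by_contra hlt
  push Not at hlt
  set a := lam x
  set d := lam (x + Pi.single i 1 + Pi.single j 1)
  have hd : d ≠ 0 := by rintro hd; simp [hd] at hlt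
  have ha : a ≠ 0 := by rintro ha; simp [ha] at hlt
  have hpos : 0 < -(a / d) := by
    have : a / d < 0 := by
      rw [← mul_div_mul_right a d hd]
      exact div_neg_of_neg_of_pos hlt (mul_self_pos.2 hd)
    linarith
  rcases h with h | h
  · set t := Real.sqrt (-(a / d)) with ht
    have htp : 0 < t := Real.sqrt_pos.2 hpos
    refine h (t * Complex.I) (t * Complex.I) (by simpa using htp) (by simpa using htp)
      (fun _ => rfl) ?_
    have h1 : t * t * d = -a := by
      rw [ht, Real.mul_self_sqrt hpos.le]
      field_simp
    have h2 : (t : ℂ) * t * d = -a := by exact_mod_cast h1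
    push_cast
    linear_combination (d : ℂ) * t * t * Complex.I_mul_I - h2
  · have h1 := congrArg Complex.re (h Complex.I Complex.I (by simp) (by simp) fun _ => rfl)
    have h2 := congrArg Complex.re
      (h (2 * Complex.I) (2 * Complex.I) (by simp) (by simp) fun _ => rfl)
    simp at h1 h2
    exact hd (by linarith)

/-- Each restriction of a multivariate multiplier sequence to a coordinate line is a multiplier
sequence. -/
theorem IsMultivariateMultiplierSequence.line {n : ℕ} {lam : (Fin n → ℕ) → ℝ}
    (hlam : IsMultivariateMultiplierSequence lam) (x : Fin n → ℕ) (i : Fin n) :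
    IsMultiplierSequence fun k => lam (Function.update x i k) := by
  intro p hp
  set q := univariateDiagonalOperator (fun k => lam (Function.update x i k)) p with hq
  have hprod : ∀ (z : Fin n → ℂ) (k : ℕ), ∏ l, z l ^ Function.update x i k l =
      (∏ l ∈ Finset.univ.erase i, z l ^ x l) * z i ^ k := by
    intro z k
    rw [← Finset.mul_prod_erase _ _ (Finset.mem_univ i), Function.update_self, mul_comm]
    congr 1
    refine Finset.prod_congr rfl fun l hl => ?_
    rw [Function.update_of_ne (Finset.ne_of_mem_erase hl)]
  have key : ∀ (r : Polynomial ℝ), r.natDegree ≤ p.natDegree → ∀ z : Fin n → ℂ,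
      ∑ k ∈ Finset.range (p.natDegree + 1), ((r.coeff k : ℝ) : ℂ) *
        ∏ l, z l ^ Function.update x i k l =
      (∏ l ∈ Finset.univ.erase i, z l ^ x l) * Polynomial.aeval (z i) r := by
    intro r hr z
    rw [Polynomial.aeval_eq_sum_range' (Nat.lt_succ_of_le hr), Finset.mul_sum]
    refine Finset.sum_congr rfl fun k _ => ?_
    rw [hprod, Complex.real_smul]
    ring
  have hqd : q.natDegree ≤ p.natDegree := Polynomial.natDegree_le_iff_coeff_eq_zero.2 fun k hk => by
    rw [hq, coeff_univariateDiagonalOperator, Polynomial.coeff_eq_zero_of_natDegree_lt hk, mul_zero]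
  have h := hlam.test (Finset.range (p.natDegree + 1)) (fun k => Function.update x i k) p.coeff
    fun z hz => by
      rw [key p le_rfl]
      exact mul_ne_zero (prod_pow_ne_zero hz x _) (isHyperbolic_iff.1 hp _ (hz i))
  simp only [← coeff_univariateDiagonalOperator (fun k => lam (Function.update x i k)) p,
    ← hq] at h
  refine h.imp (fun h1 => ?_) fun h1 => ?_
  · rw [isHyperbolic_iff]
    intro w hw
    have h2 := h1 (fun _ => w) fun _ => hw
    rw [key q hqd] at h2
    exact right_ne_zero_of_mul h2
  · ext k
    rw [Polynomial.coeff_zero]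
    by_cases hk : k ∈ Finset.range (p.natDegree + 1)
    · rw [← coeff_testPolynomial (Finset.range (p.natDegree + 1))
        (Function.update_injective x i) q.coeff hk, h1, MvPolynomial.coeff_zero]
    · refine Polynomial.coeff_eq_zero_of_natDegree_lt (hqd.trans_lt ?_)
      rw [Finset.mem_range] at hk
      omega

/-! ### The support of a multivariate multiplier sequence -/

/-- Every point of the upper half-plane, and every negative real number if `m ≥ 2`, has an `m`-th
root in the upper half-plane. -/
theorem exists_pow_eq_of_arg_pos {w : ℂ} {m : ℕ} (hw : 0 < w.arg) (hm : 1 ≤ m)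
    (h : 2 ≤ m ∨ w.arg < Real.pi) : ∃ u : ℂ, 0 < u.im ∧ u ^ m = w := by
  have hw0 : w ≠ 0 := by rintro rfl; simp at hw
  refine ⟨w ^ ((m : ℂ)⁻¹), ?_, Complex.cpow_nat_inv_pow w (by omega)⟩
  have hm' : (1 : ℝ) ≤ m := by exact_mod_cast hm
  have hlt : w.arg * (m : ℝ)⁻¹ < Real.pi := by
    rw [← div_eq_mul_inv, div_lt_iff₀ (by linarith)]
    rcases h with h | h
    · have h2 : (2 : ℝ) ≤ m := by exact_mod_cast h
      nlinarith [Complex.arg_le_pi w, Real.pi_pos]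
    · nlinarith [Real.pi_pos]
  have him : (Complex.log w * (m : ℂ)⁻¹).im = w.arg * (m : ℝ)⁻¹ := by
    rw [← Complex.ofReal_natCast, ← Complex.ofReal_inv, Complex.im_mul_ofReal, Complex.log_im]
  rw [Complex.cpow_def_of_ne_zero hw0, Complex.exp_im, him]
  exact mul_pos (Real.exp_pos _) (Real.sin_pos_of_pos_of_lt_pi (by positivity) hlt)

/-- One of the two binomials `b u ^ P ± a v ^ N` is not stable if `P + N ≥ 2`. -/
theorem exists_binomial_zero {a b : ℝ} (ha : a ≠ 0) (hb : b ≠ 0) {P N : ℕ} (h : 2 ≤ P + N) :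
    ∃ u v : ℂ, ∃ ε : ℝ, 0 < u.im ∧ 0 < v.im ∧ (ε = 1 ∨ ε = -1) ∧
      (ε : ℂ) * a * v ^ N + b * u ^ P = 0 := by
  have hsign : ∀ {c d : ℝ}, |c| = |d| → ∃ ε : ℝ, (ε = 1 ∨ ε = -1) ∧ ε * c = d := by
    intro c d hcd
    rcases abs_eq_abs.1 hcd with rfl | rfl
    · exact ⟨1, Or.inl rfl, one_mul _⟩
    · exact ⟨-1, Or.inr rfl, by ring⟩
  have hneg : ∀ {c d : ℝ}, c ≠ 0 → d ≠ 0 → 0 < ((-|c / d| : ℝ) : ℂ).arg := by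
    intro c d hc hd
    rw [Complex.arg_ofReal_of_neg (neg_neg_of_pos (abs_pos.2 (div_ne_zero hc hd)))]
    exact Real.pi_pos
  rcases Nat.eq_zero_or_pos N with rfl | hN
  · obtain ⟨u, hu, huP⟩ := exists_pow_eq_of_arg_pos (m := P) (hneg ha hb) (by omega)
      (Or.inl (by omega))
    obtain ⟨ε, hε, he⟩ := hsign (c := a) (d := b * |a / b|) (by
      rw [abs_mul, abs_abs, abs_div]; field_simp)
    refine ⟨u, Complex.I, ε, hu, by simp, hε, ?_⟩
    rw [huP, pow_zero, mul_one]
    have : ε * a + b * -|a / b| = 0 := by linarith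
    exact_mod_cast this
  rcases Nat.eq_zero_or_pos P with rfl | hP
  · obtain ⟨v, hv, hvN⟩ := exists_pow_eq_of_arg_pos (m := N) (hneg hb ha) (by omega)
      (Or.inl (by omega))
    obtain ⟨ε, hε, he⟩ := hsign (c := a * |b / a|) (d := b) (by
      rw [abs_mul, abs_abs, abs_div]; field_simp)
    refine ⟨Complex.I, v, ε, by simp, hv, hε, ?_⟩
    rw [hvN, pow_zero, mul_one]
    have : ε * a * -|b / a| + b = 0 := by linarith
    exact_mod_cast this
  · have hr : 0 < |a / b| := abs_pos.2 (div_ne_zero ha hb)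
    have hI : Complex.I.arg < Real.pi := by
      rw [Complex.arg_I]; linarith [Real.pi_pos]
    have hI' : 0 < Complex.I.arg := by
      rw [Complex.arg_I]; linarith [Real.pi_pos]
    obtain ⟨v, hv, hvN⟩ := exists_pow_eq_of_arg_pos (m := N) hI' hN (Or.inr hI)
    obtain ⟨u, hu, huP⟩ := exists_pow_eq_of_arg_pos (w := ((|a / b| : ℝ) : ℂ) * Complex.I)
      (m := P) (by rwa [Complex.arg_real_mul _ hr]) hP
      (Or.inr (by rwa [Complex.arg_real_mul _ hr]))
    obtain ⟨ε, hε, he⟩ := hsign (c := a) (d := -(b * |a / b|)) (by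
      rw [abs_neg, abs_mul, abs_abs, abs_div]; field_simp)
    refine ⟨u, v, ε, hu, hv, hε, ?_⟩
    rw [hvN, huP]
    have h1 : (ε : ℂ) * a = -(b * (|a / b| : ℝ)) := by exact_mod_cast he
    linear_combination Complex.I * h1

/-- `γ` lies in the box spanned by the opposite corners `α` and `β`. -/
def InBox {n : ℕ} (α γ β : Fin n → ℕ) : Prop :=
  ∀ i, (α i ≤ γ i ∧ γ i ≤ β i) ∨ (β i ≤ γ i ∧ γ i ≤ α i)

/-- The `ℓ¹` distance of two exponents. -/
def gridDist {n : ℕ} (α β : Fin n → ℕ) : ℕ := ∑ i, ((α i - β i) + (β i - α i))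

theorem gridDist_eq_zero {n : ℕ} {α β : Fin n → ℕ} (h : gridDist α β = 0) : α = β := by
  funext i
  have := Finset.sum_eq_zero_iff.1 h i (Finset.mem_univ i)
  omega

theorem gridDist_pos {n : ℕ} {α β : Fin n → ℕ} (h : α ≠ β) : 0 < gridDist α β :=
  Nat.pos_of_ne_zero fun h0 => h (gridDist_eq_zero h0)

theorem InBox.gridDist_add {n : ℕ} {α γ β : Fin n → ℕ} (h : InBox α γ β) :
    gridDist α γ + gridDist γ β = gridDist α β := by
  rw [gridDist, gridDist, gridDist, ← Finset.sum_add_distrib]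
  refine Finset.sum_congr rfl fun i _ => ?_
  have := h i
  omega

theorem inBox_update {n : ℕ} {α β : Fin n → ℕ} {i : Fin n} {k : ℕ}
    (h : (α i ≤ k ∧ k ≤ β i) ∨ (β i ≤ k ∧ k ≤ α i)) : InBox α (Function.update α i k) β := by
  intro j
  rcases eq_or_ne j i with rfl | hj
  · rwa [Function.update_self]
  · rw [Function.update_of_ne hj]; omega

theorem InBox.symm {n : ℕ} {α γ β : Fin n → ℕ} (h : InBox α γ β) : InBox β γ α :=
  fun i => (h i).symm

open Polynomial in
/-- The polynomial `z ^ l (z + ε) (z + 1) ^ (m - l - 1)` is hyperbolic, and its extreme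
coefficients have the relative sign `ε`. -/
theorem exists_hyperbolic_extreme_coeff (l m : ℕ) (ε : ℝ) (h : l = m → ε = 1) (hlm : l ≤ m) :
    ∃ p : ℝ[X], p.natDegree ≤ m ∧ (∀ k < l, p.coeff k = 0) ∧ p.coeff l = ε ∧ p.coeff m = 1 ∧
      ∀ z : ℂ, 0 < z.im → aeval z p ≠ 0 := by
  have hne : ∀ {z : ℂ}, 0 < z.im → ∀ r : ℝ, z + r ≠ 0 := fun hz r h0 => by
    have := congrArg Complex.im h0
    simp at this
    exact hz.ne' this
  have hz0 : ∀ {z : ℂ}, 0 < z.im → z ≠ 0 := fun hz h0 => by simp [h0] at hz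
  rcases eq_or_lt_of_le hlm with rfl | hlt
  · refine ⟨X ^ l, natDegree_X_pow_le l, fun k hk => ?_, ?_, ?_, fun z hz => ?_⟩
    · rw [coeff_X_pow, if_neg hk.ne]
    · rw [coeff_X_pow, if_pos rfl, h rfl]
    · rw [coeff_X_pow, if_pos rfl]
    · rw [map_pow, aeval_X]; exact pow_ne_zero _ (hz0 hz)
  · obtain ⟨d, rfl⟩ := Nat.exists_eq_add_of_lt hlt
    have hmon : ((X + C ε) * (X + C 1) ^ d : ℝ[X]).Monic :=
      (monic_X_add_C ε).mul ((monic_X_add_C 1).pow d)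
    have hdeg : ((X + C ε) * (X + C 1) ^ d : ℝ[X]).natDegree = d + 1 := by
      rw [(monic_X_add_C ε).natDegree_mul ((monic_X_add_C 1).pow d), natDegree_X_add_C,
        (monic_X_add_C (1 : ℝ)).natDegree_pow, natDegree_X_add_C]
      ring
    refine ⟨X ^ l * ((X + C ε) * (X + C 1) ^ d), ?_, fun k hk => ?_, ?_, ?_, fun z hz => ?_⟩
    · refine natDegree_mul_le.trans ?_
      rw [hdeg, natDegree_X_pow]
      omega
    · rw [coeff_X_pow_mul', if_neg (by omega)]
    · rw [coeff_X_pow_mul', if_pos le_rfl, Nat.sub_self, coeff_zero_eq_eval_zero]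
      simp
    · rw [coeff_X_pow_mul', if_pos (by omega), show l + d + 1 - l = d + 1 by omega, ← hdeg]
      exact hmon
    · rw [map_mul, map_mul, map_pow, map_pow, map_add, map_add, aeval_X, aeval_C, aeval_C]
      exact mul_ne_zero (pow_ne_zero _ (hz0 hz))
        (mul_ne_zero (hne hz ε) (pow_ne_zero _ (hne hz 1)))

/-- If `lam` vanishes at all points of a box except the opposite corners `α` and `β`, then the
binomials `ε lam(α) z^α + lam(β) z^β` are stable for both signs `ε`. -/
theorem IsMultivariateMultiplierSequence.corner_binomial {n : ℕ} {lam : (Fin n → ℕ) → ℝ}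
    (hlam : IsMultivariateMultiplierSequence lam) {α β : Fin n → ℕ} (hα : lam α ≠ 0)
    (hgap : ∀ γ, InBox α γ β → γ ≠ α → γ ≠ β → lam γ = 0) {i₀ : Fin n} (hi₀ : α i₀ < β i₀)
    {ε : ℝ} (hε : ε = 1 ∨ ε = -1) {z : Fin n → ℂ} (hz : ∀ j, 0 < (z j).im) :
    (ε : ℂ) * lam α * ∏ i, z i ^ α i + lam β * ∏ i, z i ^ β i ≠ 0 := by
  have hε0 : ε ≠ 0 := by rcases hε with rfl | rfl <;> norm_num
  have hαβ : α ≠ β := by rintro rfl; exact lt_irrefl _ hi₀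
  choose p hpd hpl hpmin hpmax hpz using fun i =>
    exists_hyperbolic_extreme_coeff (min (α i) (β i)) (max (α i) (β i)) (if i = i₀ then ε else 1)
      (fun h => by
        split_ifs with hi
        · subst hi; omega
        · rfl) (by omega)
  set A : Finset (Fin n → ℕ) :=
    Fintype.piFinset fun i => Finset.range (max (α i) (β i) + 1) with hA
  set c : (Fin n → ℕ) → ℝ := fun γ => ∏ i, (p i).coeff (γ i) with hc
  have hAα : α ∈ A := Fintype.mem_piFinset.2 fun i => Finset.mem_range.2 (by omega)
  have hAβ : β ∈ A := Fintype.mem_piFinset.2 fun i => Finset.mem_range.2 (by omega)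
  have hcβ : c β = 1 := by
    refine Finset.prod_eq_one fun i _ => ?_
    rcases le_total (α i) (β i) with h | h
    · have := hpmax i; rwa [max_eq_right h] at this
    · have h1 := hpmin i
      rw [min_eq_right h, if_neg] at h1
      · exact h1
      · rintro rfl; omega
  have hcα : c α = ε := by
    rw [hc]
    beta_reduce
    rw [← Finset.mul_prod_erase _ _ (Finset.mem_univ i₀)]
    have h1 := hpmin i₀
    rw [min_eq_left hi₀.le, if_pos rfl] at h1
    rw [h1, Finset.prod_eq_one, mul_one]
    intro i hi
    rcases le_total (α i) (β i) with h | h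
    · have h2 := hpmin i
      rwa [min_eq_left h, if_neg (Finset.ne_of_mem_erase hi)] at h2
    · have := hpmax i; rwa [max_eq_left h] at this
  have htest := hlam.test A id c fun w hw => by
    have h1 : ∑ γ ∈ A, (c γ : ℂ) * ∏ i, w i ^ γ i = ∏ i, Polynomial.aeval (w i) (p i) := by
      rw [Finset.prod_congr rfl fun i _ =>
        Polynomial.aeval_eq_sum_range' (Nat.lt_succ_of_le (hpd i)) (w i), Finset.prod_univ_sum]
      refine Finset.sum_congr rfl fun γ _ => ?_
      simp only [hc, Complex.ofReal_prod, Complex.real_smul, Finset.prod_mul_distrib]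
    simp only [id_eq]
    rw [h1]
    exact Finset.prod_ne_zero_iff.2 fun i _ => hpz i _ (hw i)
  rcases htest with h | h
  · have h1 := h z hz
    rw [Finset.sum_eq_add_of_mem α β hAα hAβ hαβ] at h1
    · simp only [id_eq, hcα, hcβ] at h1
      push_cast at h1
      rwa [mul_one, mul_comm (lam α : ℂ)] at h1
    · intro γ hγ hne
      by_cases hbox : InBox α γ β
      · simp [hgap γ hbox hne.1 hne.2]
      · have hc0 : c γ = 0 := by
          unfold InBox at hbox
          push Not at hbox
          obtain ⟨i, hi⟩ := hbox
          have hle := Finset.mem_range.1 (Fintype.mem_piFinset.1 hγ i)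
          exact Finset.prod_eq_zero (Finset.mem_univ i) (hpl i _ (by omega))
        simp [hc0]
  · have h1 := coeff_testPolynomial A (a := id) Function.injective_id
      (fun γ => lam (id γ) * c γ) hAα
    rw [h, MvPolynomial.coeff_zero, hcα] at h1
    exact absurd h1.symm (mul_ne_zero hα hε0)

/-- Two points of the support at distance at least two have a third point of the support in the
box that they span. -/
theorem IsMultivariateMultiplierSequence.exists_between {n : ℕ} {lam : (Fin n → ℕ) → ℝ}
    (hlam : IsMultivariateMultiplierSequence lam) {α β : Fin n → ℕ} (hα : lam α ≠ 0)
    (hβ : lam β ≠ 0) (hd : 2 ≤ gridDist α β) :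
    ∃ γ, InBox α γ β ∧ γ ≠ α ∧ γ ≠ β ∧ lam γ ≠ 0 := by
  by_contra hno
  push Not at hno
  -- With `z_i = u` where `α i < β i` and `z_i = v` elsewhere, the binomial in `u` and `v` remains.
  obtain ⟨u, v, ε, hu, hv, hε, h0⟩ := exists_binomial_zero hα hβ
    (P := ∑ i, (β i - α i)) (N := ∑ i, (α i - β i)) (by
      rw [← Finset.sum_add_distrib]
      refine hd.trans (Finset.sum_le_sum fun i _ => ?_)
      omega)
  set z : Fin n → ℂ := fun i => if α i < β i then u else v with hzdef
  have hz : ∀ j, 0 < (z j).im := fun j => by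
    simp only [hzdef]
    split_ifs
    · exact hu
    · exact hv
  have hzα : ∏ i, z i ^ α i = (∏ i, z i ^ min (α i) (β i)) * v ^ ∑ i, (α i - β i) := by
    rw [← Finset.prod_pow_eq_pow_sum, ← Finset.prod_mul_distrib]
    refine Finset.prod_congr rfl fun i _ => ?_
    simp only [hzdef]
    split_ifs with h
    · rw [min_eq_left h.le, Nat.sub_eq_zero_of_le h.le, pow_zero, mul_one]
    · rw [← pow_add]; congr 1; omega
  have hzβ : ∏ i, z i ^ β i = (∏ i, z i ^ min (α i) (β i)) * u ^ ∑ i, (β i - α i) := by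
    rw [← Finset.prod_pow_eq_pow_sum, ← Finset.prod_mul_distrib]
    refine Finset.prod_congr rfl fun i _ => ?_
    simp only [hzdef]
    split_ifs with h
    · rw [← pow_add]; congr 1; omega
    · rw [min_eq_right (not_lt.1 h), Nat.sub_eq_zero_of_le (not_lt.1 h), pow_zero, mul_one]
  have hzero : (ε : ℂ) * lam α * ∏ i, z i ^ α i + lam β * ∏ i, z i ^ β i = 0 := by
    rw [hzα, hzβ]
    linear_combination (∏ i, z i ^ min (α i) (β i)) * h0
  have hne : α ≠ β := by
    rintro rfl
    simp [gridDist] at hd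
  obtain ⟨i₀, hi₀⟩ := Function.ne_iff.1 hne
  rcases lt_or_gt_of_ne hi₀ with hlt | hgt
  · exact hlam.corner_binomial hα hno hlt hε hz hzero
  · refine hlam.corner_binomial hβ (fun γ hγ h1 h2 => hno γ hγ.symm h2 h1) hgt hε hz ?_
    rcases hε with rfl | rfl
    · rw [← hzero]; push_cast; ring
    · rw [← neg_eq_zero, ← hzero]; push_cast; ring

theorem update_update_add_single {n : ℕ} (x : Fin n → ℕ) {i j : Fin n} (hij : i ≠ j) (k l : ℕ) :
    Function.update (Function.update x i k) j l + Pi.single i 1 =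
      Function.update (Function.update x i (k + 1)) j l ∧
    Function.update (Function.update x i k) j l + Pi.single j 1 =
      Function.update (Function.update x i k) j (l + 1) := by
  constructor <;> funext m <;> rcases eq_or_ne m j with rfl | hj
  · simp [Pi.single_eq_of_ne hij.symm]
  · rcases eq_or_ne m i with rfl | hi
    · simp [hij]
    · simp [hi, hj]
  · simp
  · simp [hj]

/-- The minors vanish for every orientation of a unit square. -/
theorem IsMultivariateMultiplierSequence.minor_update {n : ℕ} {lam : (Fin n → ℕ) → ℝ}
    (hlam : IsMultivariateMultiplierSequence lam) (x : Fin n → ℕ) {i j : Fin n} (hij : i ≠ j)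
    {k k' l l' : ℕ} (hk : k' = k + 1 ∨ k = k' + 1) (hl : l' = l + 1 ∨ l = l' + 1) :
    lam (Function.update (Function.update x i k) j l) *
        lam (Function.update (Function.update x i k') j l') =
      lam (Function.update (Function.update x i k') j l) *
        lam (Function.update (Function.update x i k) j l') := by
  have base : ∀ k l : ℕ, lam (Function.update (Function.update x i k) j l) *
        lam (Function.update (Function.update x i (k + 1)) j (l + 1)) =
      lam (Function.update (Function.update x i (k + 1)) j l) *
        lam (Function.update (Function.update x i k) j (l + 1)) := by
    intro k l
    have h := hlam.minor (Function.update (Function.update x i k) j l) hij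
    rwa [(update_update_add_single x hij k l).1, (update_update_add_single x hij k l).2,
      (update_update_add_single x hij (k + 1) l).2] at h
  rcases hk with rfl | rfl <;> rcases hl with rfl | rfl
  · exact base k l
  · linarith [base k l']
  · linarith [base k' l]
  · linarith [base k' l']

/-- The support of a multivariate multiplier sequence contains with any two points the box that
they span. -/
theorem IsMultivariateMultiplierSequence.ne_zero_of_inBox {n : ℕ} {lam : (Fin n → ℕ) → ℝ}
    (hlam : IsMultivariateMultiplierSequence lam) {α β γ : Fin n → ℕ} (hα : lam α ≠ 0)
    (hβ : lam β ≠ 0) (hγ : InBox α γ β) : lam γ ≠ 0 := by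
  induction hN : gridDist α β using Nat.strong_induction_on generalizing α β γ with
  | _ N ih =>
    subst hN
    rcases lt_or_ge (gridDist α β) 2 with hsmall | hbig
    · have h1 := hγ.gridDist_add
      rcases Nat.eq_zero_or_pos (gridDist α γ) with h | h
      · rwa [← gridDist_eq_zero h]
      · rwa [gridDist_eq_zero (α := γ) (β := β) (by omega)]
    · obtain ⟨γ₀, hbox, hne, hne', hγ₀⟩ := hlam.exists_between hα hβ hbig
      have hadd := hbox.gridDist_add
      have hpos := gridDist_pos hne'
      obtain ⟨i, hi⟩ := Function.ne_iff.1 hne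
      -- A neighbour `α'` of `α` in the direction of `γ₀` belongs to the support.
      obtain ⟨k', hk', hkγ⟩ : ∃ k', (k' = α i + 1 ∨ α i = k' + 1) ∧
          ((α i ≤ k' ∧ k' ≤ γ₀ i) ∨ (γ₀ i ≤ k' ∧ k' ≤ α i)) := by
        rcases lt_or_gt_of_ne hi with h | h
        · exact ⟨α i - 1, by omega, by omega⟩
        · exact ⟨α i + 1, by omega, by omega⟩
      set α' := Function.update α i k' with hα'
      have hα'0 : lam α' ≠ 0 := ih _ (by omega) hα hγ₀ (inBox_update hkγ) rfl
      have hkβ : (α i ≤ k' ∧ k' ≤ β i) ∨ (β i ≤ k' ∧ k' ≤ α i) := by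
        have := hbox i
        omega
      have hboxα' : InBox α α' β := inBox_update hkβ
      have hlt : gridDist α' β < gridDist α β := by
        have h1 := hboxα'.gridDist_add
        have h2 : 0 < gridDist α α' := gridDist_pos fun h => by
          have := congrFun h i
          rw [hα', Function.update_self] at this
          omega
        omega
      have hfar : ∀ δ, InBox α' δ β → lam δ ≠ 0 := fun δ hδ => ih _ hlt hα'0 hβ hδ rfl
      -- Points outside the box of `α'` and `β` are reached by unit squares.
      have hnear : ∀ M, ∀ δ, InBox α δ β → gridDist α δ = M → lam δ ≠ 0 := by
        intro M
        induction M using Nat.strong_induction_on with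
        | _ M ihM =>
          intro δ hδ hM
          subst hM
          by_cases hδi : δ i = α i
          · by_cases hδα : δ = α
            · rwa [hδα]
            obtain ⟨j, hj⟩ := Function.ne_iff.1 hδα
            have hij : i ≠ j := by rintro rfl; exact hj hδi
            obtain ⟨l', hl', hlα⟩ : ∃ l', (l' = δ j + 1 ∨ δ j = l' + 1) ∧
                ((δ j ≤ l' ∧ l' ≤ α j) ∨ (α j ≤ l' ∧ l' ≤ δ j)) := by
              rcases lt_or_gt_of_ne hj with h | h
              · exact ⟨δ j + 1, by omega, by omega⟩
              · exact ⟨δ j - 1, by omega, by omega⟩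
            set η := Function.update δ j l' with hη
            have hηbox : InBox δ η α := inBox_update hlα
            have hη1 := hηbox.symm.gridDist_add
            have hη2 : 0 < gridDist η δ := gridDist_pos fun h => by
              have := congrFun h j
              rw [hη, Function.update_self] at this
              omega
            have hηβ : InBox α η β := fun m => by
              have h1 := hδ m
              have h2 := hηbox m
              omega
            have hη0 : lam η ≠ 0 := ihM _ (by omega) η hηβ rfl
            have hcorner : ∀ l, ((δ j ≤ l ∧ l ≤ α j) ∨ (α j ≤ l ∧ l ≤ δ j)) →
                lam (Function.update (Function.update δ i k') j l) ≠ 0 := by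
              intro l hl
              refine hfar _ fun m => ?_
              rcases eq_or_ne m j with rfl | hmj
              · rw [Function.update_self, hα', Function.update_of_ne hij.symm]
                have := hδ m
                omega
              · rw [Function.update_of_ne hmj]
                rcases eq_or_ne m i with rfl | hmi
                · rw [Function.update_self, hα', Function.update_self]
                  omega
                · rw [Function.update_of_ne hmi, hα', Function.update_of_ne hmi]
                  exact hδ m
            have hsq := hlam.minor_update δ hij (k := δ i) (k' := k') (l := δ j) (l' := l')
              (by omega) hl'
            rw [Function.update_eq_self, Function.update_eq_self] at hsq
            have hne2 := mul_ne_zero (hcorner (δ j) (by omega)) hη0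
            rw [← hsq] at hne2
            exact left_ne_zero_of_mul hne2
          · refine hfar δ fun m => ?_
            have h1 := hδ m
            rcases eq_or_ne m i with rfl | hmi
            · rw [hα', Function.update_self]
              omega
            · rwa [hα', Function.update_of_ne hmi]
      exact hnear _ γ hγ rfl

/-! ### Factorization and signs -/

/-- The support of a nonzero multivariate multiplier sequence has a least element. -/
theorem IsMultivariateMultiplierSequence.exists_least {n : ℕ} {lam : (Fin n → ℕ) → ℝ}
    (hlam : IsMultivariateMultiplierSequence lam) {β : Fin n → ℕ} (hβ : lam β ≠ 0) :
    ∃ α, lam α ≠ 0 ∧ ∀ γ, lam γ ≠ 0 → α ≤ γ := by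
  obtain ⟨α, hα, hmin⟩ := WellFounded.has_min (wellFounded_lt (α := Fin n → ℕ))
    {γ | lam γ ≠ 0} ⟨β, hβ⟩
  refine ⟨α, hα, fun γ hγ => ?_⟩
  have h1 : lam (α ⊓ γ) ≠ 0 := hlam.ne_zero_of_inBox hα hγ fun i => by
    rw [Pi.inf_apply]
    rcases le_total (α i) (γ i) with h | h
    · rw [inf_eq_left.2 h]; omega
    · rw [inf_eq_right.2 h]; omega
  have h2 := hmin _ h1
  exact inf_eq_left.1 (eq_of_le_of_not_lt inf_le_left h2)

theorem inBox_of_le {n : ℕ} {α γ β : Fin n → ℕ} (h1 : α ≤ γ) (h2 : γ ≤ β) : InBox α γ β :=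
  fun i => Or.inl ⟨h1 i, h2 i⟩

theorem exists_eq_add_single {n : ℕ} {x y : Fin n → ℕ} {i : Fin n} (hxy : x ≤ y)
    (hi : x i < y i) : ∃ w, x ≤ w ∧ w ≤ y ∧ y = w + Pi.single i 1 ∧ ∑ k, y k = ∑ k, w k + 1 := by
  have hy : y = Function.update y i (y i - 1) + Pi.single i 1 := by
    funext k
    rcases eq_or_ne k i with rfl | hk
    · simp; omega
    · simp [hk]
  refine ⟨Function.update y i (y i - 1), ?_, ?_, hy, ?_⟩
  · intro k
    rcases eq_or_ne k i with rfl | hk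
    · rw [Function.update_self]; exact Nat.le_pred_of_lt hi
    · rw [Function.update_of_ne hk]; exact hxy k
  · intro k
    rcases eq_or_ne k i with rfl | hk
    · rw [Function.update_self]; exact Nat.sub_le _ _
    · rw [Function.update_of_ne hk]
  · conv_lhs => rw [hy]
    simp [Finset.sum_add_distrib]

theorem exists_lt_of_le_of_ne {n : ℕ} {x y : Fin n → ℕ} (hxy : x ≤ y) (hne : y ≠ x) :
    ∃ i, x i < y i := by
  obtain ⟨i, hi⟩ := Function.ne_iff.1 hne
  exact ⟨i, lt_of_le_of_ne (hxy i) hi.symm⟩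

section Least

variable {n : ℕ} {lam : (Fin n → ℕ) → ℝ} {α₀ : Fin n → ℕ}

/-- The ratio of the values at `y + e_j` and `y` depends only on the coordinate `y j`. -/
theorem IsMultivariateMultiplierSequence.ratio_eq (hlam : IsMultivariateMultiplierSequence lam)
    (h0 : lam α₀ ≠ 0) (hle : ∀ γ, lam γ ≠ 0 → α₀ ≤ γ) (j : Fin n) {y : Fin n → ℕ}
    (hy : lam y ≠ 0) :
    lam (y + Pi.single j 1) * lam (Function.update α₀ j (y j)) =
      lam y * lam (Function.update α₀ j (y j + 1)) := by
  induction hN : ∑ i, y i generalizing y with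
  | zero =>
    have h1 : y = α₀ := by
      have h2 : y = 0 := by
        funext i
        exact Finset.sum_eq_zero_iff.1 hN i (Finset.mem_univ i)
      have h3 := hle y hy
      rw [h2] at h3 ⊢
      exact (le_antisymm h3 fun i => Nat.zero_le _).symm
    subst h1
    rw [Function.update_eq_self, mul_comm]
    congr 2
    funext k
    rcases eq_or_ne k j with rfl | hk
    · simp
    · simp [hk]
  | succ N ih =>
    by_cases hyx : ∃ i, i ≠ j ∧ α₀ i < y i
    · obtain ⟨i, hij, hi⟩ := hyx
      obtain ⟨w, hw1, hw2, rfl, hw⟩ := exists_eq_add_single (hle y hy) hi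
      have hw0 : lam w ≠ 0 := hlam.ne_zero_of_inBox h0 hy (inBox_of_le hw1 hw2)
      have h1 := ih hw0 (by omega)
      have h2 := hlam.minor w hij
      have h3 : (w + Pi.single i 1 : Fin n → ℕ) j = w j := by simp [Pi.single_eq_of_ne hij.symm]
      rw [h3]
      refine mul_left_cancel₀ hw0 ?_
      linear_combination lam (Function.update α₀ j (w j)) * h2 + lam (w + Pi.single i 1) * h1
    · push Not at hyx
      have h1 : ∀ k, Function.update α₀ j k = Function.update y j k := by
        intro k
        funext m
        rcases eq_or_ne m j with rfl | hm
        · simp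
        · rw [Function.update_of_ne hm, Function.update_of_ne hm]
          exact le_antisymm (hle y hy m) (hyx m hm)
      rw [h1, h1, Function.update_eq_self, mul_comm]
      congr 2
      funext m
      rcases eq_or_ne m j with rfl | hm
      · simp
      · simp [hm]

theorem IsMultivariateMultiplierSequence.factorization_of_ne_zero
    (hlam : IsMultivariateMultiplierSequence lam) (h0 : lam α₀ ≠ 0)
    (hle : ∀ γ, lam γ ≠ 0 → α₀ ≤ γ) {α : Fin n → ℕ} (hα : lam α ≠ 0) :
    lam α = lam α₀ * ∏ i, lam (Function.update α₀ i (α i)) / lam α₀ := by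
  induction hN : ∑ i, α i using Nat.strong_induction_on generalizing α with
  | _ N ih =>
    by_cases heq : α = α₀
    · subst heq
      simp only [Function.update_eq_self, div_self h0, Finset.prod_const_one, mul_one]
    · obtain ⟨j, hj⟩ := exists_lt_of_le_of_ne (hle α hα) heq
      obtain ⟨w, hw1, hw2, hαw, hw⟩ := exists_eq_add_single (hle α hα) hj
      have hw0 : lam w ≠ 0 := hlam.ne_zero_of_inBox h0 hα (inBox_of_le hw1 hw2)
      have h1 := ih _ (by omega) hw0 rfl
      have h2 := hlam.ratio_eq h0 hle j hw0
      have h3 : lam (Function.update α₀ j (w j)) ≠ 0 :=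
        hlam.ne_zero_of_inBox h0 hw0 (inBox_update (Or.inl ⟨hw1 j, le_rfl⟩))
      have hαj : α j = w j + 1 := by rw [hαw]; simp
      have h4 : ∏ i ∈ Finset.univ.erase j, lam (Function.update α₀ i (α i)) / lam α₀ =
          ∏ i ∈ Finset.univ.erase j, lam (Function.update α₀ i (w i)) / lam α₀ := by
        refine Finset.prod_congr rfl fun i hi => ?_
        rw [hαw, Pi.add_apply, Pi.single_eq_of_ne (Finset.ne_of_mem_erase hi), add_zero]
      refine mul_right_cancel₀ h3 ?_
      conv_lhs => rw [hαw, h2, h1]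
      rw [← Finset.mul_prod_erase _ _ (Finset.mem_univ j),
        ← Finset.mul_prod_erase _ (fun i => lam (Function.update α₀ i (α i)) / lam α₀)
          (Finset.mem_univ j), h4, hαj]
      ring

/-- A multivariate multiplier sequence is the product of its restrictions to the coordinate lines
through the least point of its support. -/
theorem IsMultivariateMultiplierSequence.factorization
    (hlam : IsMultivariateMultiplierSequence lam) (h0 : lam α₀ ≠ 0)
    (hle : ∀ γ, lam γ ≠ 0 → α₀ ≤ γ) (α : Fin n → ℕ) :
    lam α = lam α₀ * ∏ i, lam (Function.update α₀ i (α i)) / lam α₀ := by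
  by_cases hα : lam α = 0
  swap
  · exact hlam.factorization_of_ne_zero h0 hle hα
  rw [hα, eq_comm]
  refine mul_eq_zero_of_right _ ?_
  by_contra hprod
  have hline : ∀ i, lam (Function.update α₀ i (α i)) ≠ 0 := fun i hi =>
    Finset.prod_ne_zero_iff.1 hprod i (Finset.mem_univ i) (by rw [hi, zero_div])
  have key : ∀ s : Finset (Fin n), lam (s.piecewise α α₀) ≠ 0 := by
    intro s
    induction s using Finset.induction_on with
    | empty => simpa using h0
    | insert j s hj ih =>
      refine hlam.ne_zero_of_inBox ih (hline j) fun i => ?_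
      rcases eq_or_ne i j with rfl | hij
      · rw [Finset.piecewise_insert_self, Function.update_self]
        omega
      · rw [Finset.piecewise_insert_of_ne _ _ _ hij, Function.update_of_ne hij]
        omega
  have h1 := key Finset.univ
  rw [Finset.piecewise_univ] at h1
  exact h1 hα

/-- The first step away from the least point of the support determines the sign pattern. -/
theorem IsMultivariateMultiplierSequence.exists_sign (hlam : IsMultivariateMultiplierSequence lam)
    (h0 : lam α₀ ≠ 0) : ∃ σ : ℝ, (σ = 1 ∨ σ = -1) ∧
      ∀ i, 0 ≤ σ * (lam α₀ * lam (α₀ + Pi.single i 1)) := by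
  by_cases h : ∃ j, lam α₀ * lam (α₀ + Pi.single j 1) < 0
  · obtain ⟨j, hj⟩ := h
    refine ⟨-1, Or.inr rfl, fun i => ?_⟩
    rcases eq_or_ne i j with rfl | hij
    · linarith
    · have h1 := hlam.two_step_nonneg α₀ i j
      rw [hlam.minor α₀ hij] at h1
      have h2 : 0 < lam α₀ * lam α₀ := mul_self_pos.2 h0
      nlinarith [mul_nonneg h2.le h1]
  · push Not at h
    exact ⟨1, Or.inl rfl, fun i => by rw [one_mul]; exact h i⟩

theorem IsMultivariateMultiplierSequence.sign_pos (hlam : IsMultivariateMultiplierSequence lam)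
    (h0 : lam α₀ ≠ 0) (hle : ∀ γ, lam γ ≠ 0 → α₀ ≤ γ) {σ : ℝ} (hσ : σ = 1 ∨ σ = -1)
    (hstep : ∀ i, 0 ≤ σ * (lam α₀ * lam (α₀ + Pi.single i 1))) {α : Fin n → ℕ}
    (hα : lam α ≠ 0) : 0 < σ ^ ((∑ i, α i) + ∑ i, α₀ i) * (lam α₀ * lam α) := by
  have hσ2 : σ * σ = 1 := by rcases hσ with rfl | rfl <;> norm_num
  have hσ0 : σ ≠ 0 := by rintro rfl; norm_num at hσ2
  have hσm : ∀ m : ℕ, σ ^ (m + m) = 1 := fun m => by rw [pow_add, ← mul_pow, hσ2, one_pow]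
  induction hN : ∑ i, α i using Nat.strong_induction_on generalizing α with
  | _ N ih =>
    subst hN
    by_cases heq : α = α₀
    · subst heq
      rw [hσm, one_mul]
      exact mul_self_pos.2 h0
    · obtain ⟨j, hj⟩ := exists_lt_of_le_of_ne (hle α hα) heq
      obtain ⟨y, hy1, hy2, rfl, hy⟩ := exists_eq_add_single (hle α hα) hj
      have hy0 : lam y ≠ 0 := hlam.ne_zero_of_inBox h0 hα (inBox_of_le hy1 hy2)
      rw [hy]
      by_cases heq' : y = α₀
      · subst heq'
        rw [show ∑ k, y k + 1 + ∑ i, y i = (∑ i, y i + ∑ i, y i) + 1 by ring, pow_succ, hσm,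
          one_mul]
        exact lt_of_le_of_ne (hstep j) (mul_ne_zero hσ0 (mul_ne_zero h0 hα)).symm
      · obtain ⟨i, hi⟩ := exists_lt_of_le_of_ne hy1 heq'
        obtain ⟨w, hw1, hw2, rfl, hw⟩ := exists_eq_add_single hy1 hi
        have hw0 : lam w ≠ 0 := hlam.ne_zero_of_inBox h0 hy0 (inBox_of_le hw1 hw2)
        have h1 := ih _ (by omega) hw0 rfl
        have h2 := lt_of_le_of_ne (hlam.two_step_nonneg w i j) (mul_ne_zero hw0 hα).symm
        rw [hw, show ∑ k, w k + 1 + 1 + ∑ i, α₀ i = (∑ i, w i + ∑ i, α₀ i) + 2 by ring, pow_add,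
          pow_two, hσ2, mul_one]
        have h3 := mul_pos h1 h2
        refine pos_of_mul_pos_left (b := lam w * lam w) ?_ (mul_self_nonneg _)
        calc (0 : ℝ) < _ := h3
          _ = _ := by ring

theorem IsMultivariateMultiplierSequence.sign_nonneg
    (hlam : IsMultivariateMultiplierSequence lam) (h0 : lam α₀ ≠ 0)
    (hle : ∀ γ, lam γ ≠ 0 → α₀ ≤ γ) : ∃ σ : ℝ, (σ = 1 ∨ σ = -1) ∧
      ∀ α β : Fin n → ℕ, 0 ≤ σ ^ ((∑ i, α i) + (∑ i, β i)) * (lam α * lam β) := by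
  obtain ⟨σ, hσ, hstep⟩ := hlam.exists_sign h0
  refine ⟨σ, hσ, fun α β => ?_⟩
  by_cases hα : lam α = 0
  · simp [hα]
  by_cases hβ : lam β = 0
  · simp [hβ]
  have hσ2 : σ * σ = 1 := by rcases hσ with rfl | rfl <;> norm_num
  have h1 := mul_pos (hlam.sign_pos h0 hle hσ hstep hα) (hlam.sign_pos h0 hle hσ hstep hβ)
  refine nonneg_of_mul_nonneg_left (b := lam α₀ * lam α₀) ?_ (mul_self_pos.2 h0)
  calc (0 : ℝ) ≤ _ := h1.le
    _ = (σ * σ) ^ (∑ i, α₀ i) * (σ ^ ((∑ i, α i) + (∑ i, β i)) * (lam α * lam β) *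
        (lam α₀ * lam α₀)) := by
      rw [mul_pow, pow_add, pow_add, pow_add]; ring
    _ = _ := by rw [hσ2, one_pow, one_mul]

end Least

end RealStability

open RealStability in
theorem theorem1p7 (n : ℕ) (hn : 1 ≤ n) (lam : (Fin n → ℕ) → ℝ) :
    RealStability.IsMultivariateMultiplierSequence lam ↔
      (∃ mu : Fin n → ℕ → ℝ,
        (∀ i, RealStability.IsMultiplierSequence (mu i)) ∧
        ∀ α : Fin n → ℕ, lam α = ∏ i, mu i (α i)) ∧
      ((∀ α β : Fin n → ℕ, 0 ≤ lam α * lam β) ∨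
        (∀ α β : Fin n → ℕ, 0 ≤ (-1 : ℝ) ^ ((∑ i, α i) + (∑ i, β i)) * (lam α * lam β))) := by
  constructor
  · intro hlam
    by_cases hex : ∃ β, lam β ≠ 0
    · obtain ⟨β, hβ⟩ := hex
      obtain ⟨α₀, h0, hle⟩ := hlam.exists_least hβ
      constructor
      · -- The constant `lam α₀` goes into the first factor.
        refine ⟨fun i k => ((if i = ⟨0, hn⟩ then lam α₀ else 1) * (lam α₀)⁻¹) *
          lam (Function.update α₀ i k), fun i => (hlam.line α₀ i).const_mul _, fun α => ?_⟩
        rw [hlam.factorization h0 hle α]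
        simp only [mul_assoc]
        rw [Finset.prod_mul_distrib, Finset.prod_ite_eq' Finset.univ,
          if_pos (Finset.mem_univ _)]
        congr 1
        exact Finset.prod_congr rfl fun i _ => by rw [div_eq_mul_inv, mul_comm]
      · obtain ⟨σ, hσ, h⟩ := hlam.sign_nonneg h0 hle
        rcases hσ with rfl | rfl
        · left
          simpa only [one_pow, one_mul] using h
        · exact Or.inr h
    · push Not at hex
      refine ⟨⟨fun _ _ => 0, fun i p _ => Or.inr ?_, fun α => ?_⟩, Or.inl fun α β => ?_⟩
      · ext k
        rw [coeff_univariateDiagonalOperator, zero_mul, Polynomial.coeff_zero]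
      · rw [hex, eq_comm]
        exact Finset.prod_eq_zero (Finset.mem_univ ⟨0, hn⟩) rfl
      · rw [hex, zero_mul]
  · rintro ⟨⟨mu, hmu, hfac⟩, hsign⟩
    exact isMultivariateMultiplierSequence_of_factorization hmu hfac hsign
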